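/- **Setting.** For $\alpha\in(1,2)$ let $g_0^{(\alpha)}=1$, $g_k^{(\alpha)}=\bigl(1-\frac{\alpha+1}{k}\bigr)g_{k-1}^{(\alpha)}$ ($k\ge1$). Fix one of the two shift pairs $(p,q)\in\{(1,0),(1,-1)\}$ and let, for $(p,q)=(1,0)$, $\omega_0^{(\alpha)}=\frac{\alpha}{2}g_0^{(\alpha)}$ and $\omega_k^{(\alpha)}=\frac{\alpha}{2}g_k^{(\alpha)}+\frac{2-\alpha}{2}g_{k-1}^{(\alpha)}$ for $k\ge1$; for $(p,q)=(1,-1)$, $\omega_k^{(\alpha)}=\frac{\alpha+2}{4}g_k^{(\alpha)}$ for $k=0,1$ and $\omega_k^{(\alpha)}=\frac{\alpha+2}{4}g_k^{(\alpha)}+\frac{2-\alpha}{4}g_{k-2}^{(\alpha)}$ for $k\ge2$. Let $\mathcal G_{\alpha,M}=[\omega^{(\alpha)}_{i-j+1}]_{i,j=1}^M$ (with $\omega_k^{(\alpha)}=0$ for $k<0$), $G_{\alpha,M}=\mathcal G_{\alpha,M}+\mathcal G_{\alpha,M}^T$, and let $$f_\alpha(x)=2\sum_{k=0}^\infty\omega_k^{(\alpha)}\cos((k-1)x)$$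 be its generating function. Fix $s>0$, $\epsilon>0$, and put $\gamma(h_t,h_x)=-h_t/(2h_x^\alpha\cos(\alpha\pi/2))$, $\overline c_\alpha=-(2h_x^{\alpha}\cos(\alpha\pi/2))^{-1}$. A sequence of square matrices $A_n$ of size $d_n$ with eigenvalues $\mu_j(A_n)$ (counted with multiplicity) is *eigenvalue-distributed as* $f:D\to\mathbb C$ ($f$ measurable, $D$ of positive finite measure), written $\{A_n\}\sim_\lambda f$, if $\frac1{d_n}\sum_{j}F(\mu_j(A_n))\to\frac1{|D|}\int_DF(f(t))\,dt$ for all continuous compactly supported $F:\mathbb C\to\mathbb C$. Here $D=[-\pi,\pi]$ in 1D and $D=[-\pi,\pi]^2$ in 2D. **Theorem, one dimension.** Let $\alpha\in(1,2)$, let $M\to\infty$ along a sequence, $h_x=(b-a)/(M+1)$ with $a<b$, let $h_t>0$ tend to $0$ along the same sequence, and let $A_{\alpha,M}=(1+sh_t)I_M-\epsilon^2h_t\overline c_\alpha G_{\alpha,M}$. Then every $A_{\alpha,M}$ is symmetric positive definite, and: 1. if $\gamma\to\gamma^*<\infty$, then $\{A_{\alpha,M}\}\sim_\lambda 1-\epsilon^2\gamma^*f_\alpha(x)$;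 2. if $\gamma\to\infty$, then $\{\gamma^{-1}A_{\alpha,M}\}\sim_\lambda-\epsilon^2f_\alpha(x)$. **Theorem, two dimensions.** Let $\alpha_1,\alpha_2\in(1,2)$, let $\mathbf m=(M_1,M_2)$ vary along a sequence with $M_1,M_2\to\infty$, $h_{x_j}=(b_j-a_j)/(M_j+1)$ with $a_j<b_j$, let $h_t>0$ tend to $0$ along the same sequence, let $\gamma_j=-h_t/(2h_{x_j}^{\alpha_j}\cos(\alpha_j\pi/2))$, $\overline c_{\alpha_j}=-(2h_{x_j}^{\alpha_j}\cos(\alpha_j\pi/2))^{-1}$, $\gamma=\max(\gamma_1,\gamma_2)$, and $$A_{\boldsymbol\alpha,\mathbf m}=(1+sh_t)I-\epsilon^2h_t\bigl(\overline c_{\alpha_1}G_{\alpha_1,M_1}\otimes I_{M_2}+I_{M_1}\otimes\overline c_{\alpha_2}G_{\alpha_2,M_2}\bigr).$$ Then every $A_{\boldsymbol\alpha,\mathbf m}$ is symmetric positive definite, and: 3. if $\gamma_j\to\gamma_j^*<\infty$ for $j=1,2$, then $\{A_{\boldsymbol\alpha,\mathbf m}\}\sim_\lambda1-\epsilon^2\bigl(\gamma_1^*f_{\alpha_1}(x_1)+\gamma_2^*f_{\alpha_2}(x_2)\bigr)$;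 moreover, if $\alpha_j>\alpha_k$ and $h_{x_j}=O(h_{x_k})$, then necessarily $\gamma_k^*=0$; 4. if $\gamma\to\infty$ and one index $\hat j$ dominates, i.e. $\gamma_k/\gamma_{\hat j}\to0$ for the other index $k$, then $\{\gamma^{-1}A_{\boldsymbol\alpha,\mathbf m}\}\sim_\lambda-\epsilon^2f_{\alpha_{\hat j}}(x_{\hat j})$; this domination is automatic when $\alpha_{\hat j}>\alpha_k$ and $h_{x_{\hat j}}=O(h_{x_k})$; 5. more generally, if $\gamma\to\infty$ and $\gamma_j/\gamma\to\kappa_j$ for $j=1,2$, then $\{\gamma^{-1}A_{\boldsymbol\alpha,\mathbf m}\}\sim_\lambda-\epsilon^2\bigl(\kappa_1f_{\alpha_1}(x_1)+\kappa_2f_{\alpha_2}(x_2)\bigr)$. -/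

import Mathlib

open Filter Topology Asymptotics
open scoped Kronecker

namespace SFAC

noncomputable section

/-- Grünwald–Letnikov coefficients: `g₀ = 1`, `g_k = (1 - (α + 1) / k) g_{k-1}` for `k ≥ 1`. -/
def glCoeff (α : ℝ) : ℕ → ℝ
  | 0 => 1
  | k + 1 => (1 - (α + 1) / ((k : ℝ) + 1)) * glCoeff α k

/-- The two pairs of shifts `(p, q) = (1, 0)` and `(p, q) = (1, -1)` of the weighted and shifted
Grünwald difference formulae. -/
inductive Shifts
  | oneZero
  | oneNegOne

/-- The weights `ω_k` of the weighted and shifted Grünwald difference formula. -/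
def weight : Shifts → ℝ → ℕ → ℝ
  | .oneZero, α, 0 => α / 2 * glCoeff α 0
  | .oneZero, α, k + 1 => α / 2 * glCoeff α (k + 1) + (2 - α) / 2 * glCoeff α k
  | .oneNegOne, α, 0 => (α + 2) / 4 * glCoeff α 0
  | .oneNegOne, α, 1 => (α + 2) / 4 * glCoeff α 1
  | .oneNegOne, α, k + 2 => (α + 2) / 4 * glCoeff α (k + 2) + (2 - α) / 4 * glCoeff α k

/-- The lower Hessenberg Toeplitz matrix whose `(i, j)` entry is `ω_{i-j+1}`
(zero if `i - j + 1 < 0`). -/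
def hessToeplitz (pq : Shifts) (α : ℝ) (M : ℕ) : Matrix (Fin M) (Fin M) ℝ :=
  Matrix.of fun i j =>
    if (j : ℕ) ≤ (i : ℕ) + 1 then weight pq α ((i : ℕ) + 1 - (j : ℕ)) else 0

/-- The symmetric Toeplitz matrix `G_{α,M}`: the previous matrix plus its transpose. -/
def gMatrix (pq : Shifts) (α : ℝ) (M : ℕ) : Matrix (Fin M) (Fin M) ℝ :=
  hessToeplitz pq α M + (hessToeplitz pq α M).transpose

/-- The mesh size `(b - a) / (M + 1)` of the uniform grid on `[a, b]` with `M` interior points. -/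
def step (a b : ℝ) (M : ℕ) : ℝ := (b - a) / ((M : ℝ) + 1)

/-- The constant `c̄_α = -(2 h_x^α cos(απ/2))⁻¹`. -/
def cBar (α hx : ℝ) : ℝ := -(2 * hx ^ α * Real.cos (α * Real.pi / 2))⁻¹

/-- The ratio `γ(h_t, h_x) = -h_t / (2 h_x^α cos(απ/2))`. -/
def gam (α ht hx : ℝ) : ℝ := -ht / (2 * hx ^ α * Real.cos (α * Real.pi / 2))

/-- `A_{α,M} = (1 + s h_t) I - ε² h_t c̄_α G_{α,M}`. -/
def coeffMatrix (pq : Shifts) (s ε α ht hx : ℝ) (M : ℕ) : Matrix (Fin M) (Fin M) ℝ :=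
  (1 + s * ht) • (1 : Matrix (Fin M) (Fin M) ℝ) - (ε ^ 2 * ht * cBar α hx) • gMatrix pq α M

/-- The two-level matrix `A_{α,m} = (1 + s h_t) I - ε² h_t T_{α,m}`, where
`T_{α,m} = c̄_{α₁} G_{α₁,M₁} ⊗ I + I ⊗ c̄_{α₂} G_{α₂,M₂}` (the two directions are indexed by
`0` and `1`). -/
def coeffMatrix₂ (pq : Shifts) (s ε : ℝ) (α : Fin 2 → ℝ) (ht : ℝ) (hx : Fin 2 → ℝ)
    (M : Fin 2 → ℕ) : Matrix (Fin (M 0) × Fin (M 1)) (Fin (M 0) × Fin (M 1)) ℝ :=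
  (1 + s * ht) • (1 : Matrix (Fin (M 0) × Fin (M 1)) (Fin (M 0) × Fin (M 1)) ℝ)
    - (ε ^ 2 * ht) •
      ((cBar (α 0) (hx 0) • gMatrix pq (α 0) (M 0)) ⊗ₖ (1 : Matrix (Fin (M 1)) (Fin (M 1)) ℝ)
        + (1 : Matrix (Fin (M 0)) (Fin (M 0)) ℝ) ⊗ₖ
            (cBar (α 1) (hx 1) • gMatrix pq (α 1) (M 1)))

/-- The generating function `f_α = b_α + conj b_α`, `b_α(x) = ∑_k ω_k e^{i(k-1)x}`, of the
matrices `G_{α,M}`, that is `f_α(x) = 2 ∑_{k ≥ 0} ω_k cos((k - 1) x)`. The series converges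
absolutely for `1 < α < 2`, see `summable_weight`. -/
def symbol (pq : Shifts) (α x : ℝ) : ℝ :=
  2 * ∑' k : ℕ, weight pq α k * Real.cos (((k : ℝ) - 1) * x)

/-- `{A_n} ∼_λ (f, D)`: the square matrices `A_n` are distributed as `f` on `D` in the sense of the
eigenvalues. Here `D` has positive finite measure, `f` is measurable on `D`, and the average over
the eigenvalues of `A_n` (the roots of the characteristic polynomial, with multiplicity) of every
continuous compactly supported test function `F` tends to the mean of `F ∘ f` over `D`. -/
structure EigDistributed {X : Type*} [MeasureTheory.MeasureSpace X]
    {ι : ℕ → Type*} [∀ n, Fintype (ι n)] [∀ n, DecidableEq (ι n)]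
    (A : ∀ n, Matrix (ι n) (ι n) ℂ) (f : X → ℂ) (D : Set X) : Prop where
  measurableSet : MeasurableSet D
  volume_pos : 0 < MeasureTheory.volume D
  volume_lt_top : MeasureTheory.volume D < ⊤
  measurable : Measurable (fun x : D => f x)
  tendsto : ∀ F : ℂ → ℂ, Continuous F → HasCompactSupport F →
    Tendsto (fun n => (1 / (Fintype.card (ι n) : ℂ)) * ((A n).charpoly.roots.map F).sum) atTop
      (𝓝 ((1 / ((MeasureTheory.volume D).toReal : ℂ)) * ∫ t in D, F (f t)))

/-! The weights are absolutely summable, so that `symbol` is a convergent series. -/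

theorem glCoeff_nonneg {α : ℝ} (h1 : 1 < α) (h2 : α < 2) (k : ℕ) : 0 ≤ glCoeff α (k + 2) := by
  induction k with
  | zero =>
    have : glCoeff α (0 + 2) = α * (α - 1) / 2 := by
      simp only [glCoeff]; push_cast; ring
    rw [this]
    have : 0 < α * (α - 1) := mul_pos (by linarith) (by linarith)
    linarith
  | succ k ih =>
    rw [show k + 1 + 2 = (k + 2) + 1 from rfl, glCoeff]
    refine mul_nonneg ?_ ih
    have hk : (0 : ℝ) ≤ k := k.cast_nonneg
    rw [sub_nonneg, div_le_one (by positivity)]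
    push_cast
    linarith

theorem sum_glCoeff {α : ℝ} (n : ℕ) :
    (∑ k ∈ Finset.range (n + 1), glCoeff α k) * α = -((n : ℝ) + 1) * glCoeff α (n + 1) := by
  induction n with
  | zero => simp [glCoeff]
  | succ n ih =>
    rw [Finset.sum_range_succ, add_mul, ih, glCoeff.eq_2 α (n + 1)]
    have : (n : ℝ) + 1 + 1 ≠ 0 := by positivity
    push_cast
    field_simp
    ring

theorem summable_glCoeff {α : ℝ} (h1 : 1 < α) (h2 : α < 2) : Summable (glCoeff α) := by
  rw [← summable_nat_add_iff 2]
  refine summable_of_sum_range_le (c := α - 1) (glCoeff_nonneg h1 h2) fun n => ?_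
  have h := sum_glCoeff (α := α) (n + 1)
  have hs : ∑ k ∈ Finset.range (n + 1 + 1), glCoeff α k
      = (∑ k ∈ Finset.range n, glCoeff α (k + 2)) + (1 - α) := by
    rw [Finset.sum_range_succ', Finset.sum_range_succ']
    simp only [glCoeff]
    push_cast
    ring
  rw [hs] at h
  have hn : (0 : ℝ) ≤ n := n.cast_nonneg
  have hg := glCoeff_nonneg h1 h2 n
  have : ((∑ k ∈ Finset.range n, glCoeff α (k + 2)) + (1 - α)) * α ≤ 0 := by
    rw [h]
    push_cast
    nlinarith [mul_nonneg hn hg]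
  have := nonpos_of_mul_nonpos_left this (by linarith)
  linarith

theorem summable_weight (pq : Shifts) {α : ℝ} (h1 : 1 < α) (h2 : α < 2) :
    Summable (fun k => |weight pq α k|) := by
  have hg := summable_glCoeff h1 h2
  refine Summable.abs ?_
  cases pq with
  | oneZero =>
    rw [← summable_nat_add_iff 1]
    simp only [weight]
    exact (((summable_nat_add_iff 1).2 hg).mul_left _).add (hg.mul_left _)
  | oneNegOne =>
    rw [← summable_nat_add_iff 2]
    simp only [weight]
    exact (((summable_nat_add_iff 2).2 hg).mul_left _).add (hg.mul_left _)

end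

end SFAC

namespace SFAC

noncomputable section

/-! Eigenvalue distribution is proved by the method of moments. With even absolutely summable
coefficients `t` and f = `fourierCos t`, multiplication by f acts on cosine coefficients as
convolution with `t` (`fourierMoment_succ`). Multiplication by the Toeplitz matrix T_n is the same
convolution truncated to indices in [0, n). Hence T_n(f)^q differs from T_n(f^q) only through
indices outside the matrix. By induction on q the entrywise ℓ¹ error is o(n), because the tails of
`t` have vanishing Cesàro means (`tendsto_toeplitz_pow_sub`). Therefore the normalised trace of
T_n(f)^q tends to the mean of f^q.

Row sums bound all eigenvalues uniformly (Gershgorin), so Weierstrass approximation passes from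
monomials to continuous test functions (`eigDistributed_of_moments`). The matrices of the theorem
are combinations x I + y P + z Q with convergent scalars and commuting P, Q. The binomial theorem
thus reduces their moments to mixed moments of P and Q (`eigDistributed_combination`). In two
dimensions P = G ⊗ I and Q = I ⊗ G, so traces and integrals both factor. Every regime is one choice
of scaling factor: 1, or the reciprocal of the diverging ratio.

Positive definiteness follows from f_α ≤ 0 (`symbol_nonpos`): the quadratic form of -G is the
integral of -f_α against the squared modulus of a trigonometric polynomial, and c̄_α > 0 because
cos(απ/2) < 0. The sign of f_α comes from Σ ω_k ≤ 0, from ω_k ≥ 0 for k ≥ 4, and from an explicit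
estimate of the first four terms. -/

/-- The even function `x ↦ ∑_{k ∈ ℤ} t_k cos (k x)` with Fourier coefficients `t`. -/
def fourierCos (t : ℤ → ℝ) (x : ℝ) : ℝ := ∑' k : ℤ, t k * Real.cos (k * x)

/-- The cosine Fourier coefficients of the powers of `fourierCos t`. -/
def fourierMoment (t : ℤ → ℝ) (q : ℕ) (m : ℤ) : ℝ :=
  (2 * Real.pi)⁻¹ * ∫ x in -Real.pi..Real.pi, fourierCos t x ^ q * Real.cos (m * x)

/-- The Toeplitz matrix `[t_{i-j}]` of size `n`. -/
def toeplitz (t : ℤ → ℝ) (n : ℕ) : Matrix (Fin n) (Fin n) ℝ :=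
  Matrix.of fun i j => t ((i : ℕ) - (j : ℕ))

/-! ### Cosine coefficients of powers of an even absolutely convergent series. -/

section Fourier

variable {t : ℤ → ℝ}

theorem abs_mul_cos_le (a b : ℝ) : |a * Real.cos b| ≤ |a| := by
  rw [abs_mul]
  exact mul_le_of_le_one_right (abs_nonneg _) (Real.abs_cos_le_one _)

theorem summable_mul_cos {ι : Type*} {u : ι → ℝ} (hu : Summable fun k => |u k|) (b : ι → ℝ) :
    Summable fun k => u k * Real.cos (b k) :=
  Summable.of_norm_bounded hu fun _ => abs_mul_cos_le _ _

theorem continuous_fourierCos (ht : Summable fun k => |t k|) : Continuous (fourierCos t) := by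
  refine continuous_tsum (fun k => by fun_prop) ht fun k x => abs_mul_cos_le _ _

theorem abs_tsum_le {ι : Type*} {u v : ι → ℝ} (hv : Summable v) (h : ∀ k, |u k| ≤ v k) :
    |∑' k, u k| ≤ ∑' k, v k :=
  tsum_of_norm_bounded (f := u) hv.hasSum h

theorem abs_fourierCos_le (ht : Summable fun k => |t k|) (x : ℝ) :
    |fourierCos t x| ≤ ∑' k, |t k| :=
  abs_tsum_le ht fun _ => abs_mul_cos_le _ _

theorem tsum_odd_eq_zero {u : ℤ → ℝ} (hu : ∀ k, u (-k) = -u k) : ∑' k, u k = 0 := by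
  have h := (Equiv.neg ℤ).tsum_eq u
  simp only [Equiv.neg_apply, hu, tsum_neg] at h
  linarith

/-- After k ↦ m - k, expanding cos((m - k)x) gives a cosine part and a sine part; the sine part sums
an odd family, since t is even, and vanishes. -/
theorem fourierCos_mul_cos (ht : Summable fun k => |t k|) (he : ∀ k, t (-k) = t k)
    (m : ℤ) (x : ℝ) :
    fourierCos t x * Real.cos (m * x) = ∑' k : ℤ, t (m - k) * Real.cos (k * x) := by
  have h1 : ∑' k : ℤ, t (m - k) * Real.cos (k * x)
      = ∑' k : ℤ, t k * Real.cos ((m - k : ℤ) * x) := by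
    rw [← (Equiv.subLeft m).tsum_eq fun k : ℤ => t (m - k) * Real.cos (k * x)]
    simp
  have h2 : ∀ k : ℤ, t k * Real.cos ((m - k : ℤ) * x)
      = t k * Real.cos (k * x) * Real.cos (m * x)
        + t k * Real.sin (k * x) * Real.sin (m * x) := fun k => by
    push_cast
    rw [sub_mul, Real.cos_sub]
    ring
  have hs : Summable fun k : ℤ => t k * Real.sin (k * x) :=
    Summable.of_norm_bounded ht fun k => by
      rw [Real.norm_eq_abs, abs_mul]
      exact mul_le_of_le_one_right (abs_nonneg _) (Real.abs_sin_le_one _)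
  rw [h1, tsum_congr h2, Summable.tsum_add ((summable_mul_cos ht _).mul_right _) (hs.mul_right _),
    tsum_mul_right, tsum_mul_right, tsum_odd_eq_zero (u := fun k : ℤ => t k * Real.sin (k * x))]
  · simp [fourierCos]
  · intro k
    simp [he]

theorem fourierMoment_zero (t : ℤ → ℝ) (m : ℤ) :
    fourierMoment t 0 m = if m = 0 then 1 else 0 := by
  have hpi := Real.pi_ne_zero
  unfold fourierMoment
  split_ifs with h
  · subst h
    simp
    field_simp
    norm_num
  · have hm : (m : ℝ) ≠ 0 := by exact_mod_cast h
    have : ∫ x in -Real.pi..Real.pi, Real.cos ((m : ℝ) * x) = 0 := by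
      rw [intervalIntegral.integral_comp_mul_left _ hm, integral_cos]
      simp [Real.sin_int_mul_pi]
    simp [this]

/-- Termwise integration of `fourierCos_mul_cos`, dominated by |t (m - k)| B^q. This convolution is
what the Toeplitz matrix product imitates. -/
theorem fourierMoment_succ (ht : Summable fun k => |t k|) (he : ∀ k, t (-k) = t k)
    (q : ℕ) (m : ℤ) :
    fourierMoment t (q + 1) m = ∑' k : ℤ, t (m - k) * fourierMoment t q k := by
  have hf := continuous_fourierCos ht
  have hB := abs_fourierCos_le ht
  set B := ∑' k, |t k|
  have ht' : Summable fun k => |t (m - k)| := (Equiv.subLeft m).summable_iff.2 ht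
  have key : HasSum (fun k : ℤ => ∫ x in -Real.pi..Real.pi,
      t (m - k) * (fourierCos t x ^ q * Real.cos (k * x)))
      (∫ x in -Real.pi..Real.pi, fourierCos t x ^ (q + 1) * Real.cos (m * x)) := by
    refine intervalIntegral.hasSum_integral_of_dominated_convergence
      (fun k _ => |t (m - k)| * B ^ q) (fun k => ?_) (fun k => ?_) ?_ ?_ ?_
    · exact Continuous.aestronglyMeasurable (by fun_prop)
    · refine Eventually.of_forall fun x _ => ?_
      rw [norm_mul, norm_mul, norm_pow]
      simp only [Real.norm_eq_abs]
      gcongr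
      calc |fourierCos t x| ^ q * |Real.cos (k * x)| ≤ B ^ q * 1 := by
            gcongr
            · exact hB x
            · exact Real.abs_cos_le_one _
        _ = B ^ q := mul_one _
    · exact Eventually.of_forall fun x _ => ht'.mul_right _
    · simp
    · refine Eventually.of_forall fun x _ => ?_
      rw [pow_succ, mul_assoc, fourierCos_mul_cos ht he]
      have := ((summable_mul_cos ht' fun k : ℤ => k * x).hasSum).mul_left (fourierCos t x ^ q)
      refine this.congr_fun ?_
      intro k
      ring
  unfold fourierMoment
  rw [← key.tsum_eq, ← tsum_mul_left]
  refine tsum_congr fun k => ?_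
  rw [intervalIntegral.integral_const_mul]
  ring

/-- By induction, a convolution of two ℓ¹ families is ℓ¹: the product family is summable on ℤ × ℤ,
and the shear `e` turns it into the convolution terms. -/
theorem summable_fourierMoment (ht : Summable fun k => |t k|) (he : ∀ k, t (-k) = t k)
    (q : ℕ) : Summable fun m => |fourierMoment t q m| := by
  induction q with
  | zero =>
    refine summable_of_ne_finset_zero (s := {0}) fun m hm => ?_
    simp only [Finset.mem_singleton] at hm
    simp [fourierMoment_zero, hm]
  | succ q ih =>
    have h1 : Summable fun p : ℤ × ℤ => |t p.1| * |fourierMoment t q p.2| :=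
      ht.mul_of_nonneg ih (fun _ => abs_nonneg _) (fun _ => abs_nonneg _)
    let e : ℤ × ℤ ≃ ℤ × ℤ :=
      { toFun := fun p => (p.1 - p.2, p.2)
        invFun := fun p => (p.1 + p.2, p.2)
        left_inv := fun p => by simp
        right_inv := fun p => by simp }
    have h2 : Summable fun p : ℤ × ℤ => |t (p.1 - p.2)| * |fourierMoment t q p.2| :=
      e.summable_iff.2 h1
    refine Summable.of_nonneg_of_le (fun _ => abs_nonneg _) (fun m => ?_) h2.prod
    rw [fourierMoment_succ ht he]
    exact abs_tsum_le (h2.prod_factor m) fun k => (abs_mul _ _).le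

theorem fourierMoment_one (ht : Summable fun k => |t k|) (he : ∀ k, t (-k) = t k) (m : ℤ) :
    fourierMoment t 1 m = t m := by
  rw [fourierMoment_succ ht he, tsum_eq_single 0]
  · simp [fourierMoment_zero]
  · intro k hk
    simp [fourierMoment_zero, hk]

end Fourier

/-! ### Positivity and asymptotic trace moments of Toeplitz matrices. -/

section Toeplitz

variable {t : ℤ → ℝ}

theorem toeplitz_isHermitian (he : ∀ k, t (-k) = t k) (n : ℕ) : (toeplitz t n).IsHermitian := by
  ext i j
  simp only [toeplitz, Matrix.conjTranspose_apply, Matrix.of_apply, star_trivial]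
  rw [← he]
  congr 1
  ring

/-- The quadratic form is the mean of -f(x) |Σ v_i e^{iιx}|², where ι is the imaginary unit; the
squared modulus is written as the sum of its real and imaginary squares, and t is recovered as the
cosine coefficients of f. -/
theorem posSemidef_neg_toeplitz (ht : Summable fun k => |t k|) (he : ∀ k, t (-k) = t k)
    (hf : ∀ x, fourierCos t x ≤ 0) (n : ℕ) : (-toeplitz t n).PosSemidef := by
  refine Matrix.PosSemidef.of_dotProduct_mulVec_nonneg (toeplitz_isHermitian he n).neg fun v => ?_
  have hc := continuous_fourierCos ht
  have hq : star v ⬝ᵥ (-toeplitz t n).mulVec v = (2 * Real.pi)⁻¹ *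
      ∫ x in -Real.pi..Real.pi, -fourierCos t x *
        ((∑ i, v i * Real.cos ((i : ℕ) * x)) ^ 2 + (∑ i, v i * Real.sin ((i : ℕ) * x)) ^ 2) := by
    have hexp : ∀ x, -fourierCos t x *
        ((∑ i, v i * Real.cos ((i : ℕ) * x)) ^ 2 + (∑ i, v i * Real.sin ((i : ℕ) * x)) ^ 2)
        = ∑ i, ∑ j, -(v i * v j) *
          (fourierCos t x ^ 1 * Real.cos ((((i : ℕ) : ℤ) - ((j : ℕ) : ℤ) : ℤ) * x)) := fun x => by
      rw [sq, sq, Finset.sum_mul_sum, Finset.sum_mul_sum, ← Finset.sum_add_distrib,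
        Finset.mul_sum]
      refine Finset.sum_congr rfl fun i _ => ?_
      rw [← Finset.sum_add_distrib, Finset.mul_sum]
      refine Finset.sum_congr rfl fun j _ => ?_
      push_cast
      rw [sub_mul, Real.cos_sub]
      ring
    simp_rw [hexp]
    rw [intervalIntegral.integral_finsetSum
      fun i _ => Continuous.intervalIntegrable (by fun_prop) _ _, Finset.mul_sum]
    simp only [dotProduct, Matrix.mulVec, Finset.mul_sum]
    refine Finset.sum_congr rfl fun i _ => ?_
    rw [intervalIntegral.integral_finsetSum
      fun i _ => Continuous.intervalIntegrable (by fun_prop) _ _, Finset.mul_sum]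
    refine Finset.sum_congr rfl fun j _ => ?_
    rw [intervalIntegral.integral_const_mul]
    have := fourierMoment_one ht he (((i : ℕ) : ℤ) - ((j : ℕ) : ℤ))
    simp only [toeplitz, Matrix.neg_apply, Matrix.of_apply, ← this, fourierMoment]
    simp only [Pi.star_apply, star_trivial]
    ring
  rw [hq]
  refine mul_nonneg (by positivity) (intervalIntegral.integral_nonneg (by linarith [Real.pi_pos])
    fun x _ => mul_nonneg (by linarith [hf x]) (by positivity))

theorem sum_int_le_tsum {u : ℤ → ℝ} (hu : Summable u) (h0 : ∀ k, 0 ≤ u k) {n : ℕ}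
    (e : Fin n → ℤ) (he : Function.Injective e) : ∑ i, u (e i) ≤ ∑' k, u k := by
  have := hu.sum_le_tsum (Finset.univ.map ⟨e, he⟩) fun k _ => h0 k
  rwa [Finset.sum_map] at this

theorem toeplitz_sum_row_le (ht : Summable fun k => |t k|) (n : ℕ) (i : Fin n) :
    ∑ j, |toeplitz t n i j| ≤ ∑' k, |t k| :=
  sum_int_le_tsum ht (fun _ => abs_nonneg _) (fun j : Fin n => ((i : ℕ) : ℤ) - ((j : ℕ) : ℤ))
    fun a b h => by simpa [Fin.ext_iff] using h

theorem toeplitz_sum_col_le (ht : Summable fun k => |t k|) (n : ℕ) (j : Fin n) :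
    ∑ i, |toeplitz t n i j| ≤ ∑' k, |t k| :=
  sum_int_le_tsum ht (fun _ => abs_nonneg _) (fun i : Fin n => ((i : ℕ) : ℤ) - ((j : ℕ) : ℤ))
    fun a b h => by simpa [Fin.ext_iff] using h

/-- The part of the `ℓ¹` mass of `t` at distance at least `N` from the origin. -/
def tailMass (t : ℤ → ℝ) (N : ℕ) : ℝ := ∑' k : ℤ, if (N : ℤ) ≤ |k| then |t k| else 0

theorem summable_tailMass (ht : Summable fun k => |t k|) (N : ℕ) :
    Summable fun k : ℤ => if (N : ℤ) ≤ |k| then |t k| else 0 :=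
  Summable.of_nonneg_of_le (fun k => by split_ifs <;> positivity)
    (fun k => by split_ifs <;> simp) ht

/-- Dominated convergence: a fixed k drops out of the sum once N > |k|. -/
theorem tendsto_tailMass (ht : Summable fun k => |t k|) :
    Tendsto (tailMass t) atTop (𝓝 0) := by
  have := tendsto_tsum_of_dominated_convergence (𝓕 := atTop)
    (f := fun (N : ℕ) (k : ℤ) => if (N : ℤ) ≤ |k| then |t k| else 0) (g := fun _ => 0) ht
    (fun k => ?_) (Eventually.of_forall fun N k => ?_)
  · rw [tsum_zero] at this
    exact this
  · refine tendsto_const_nhds.congr' ?_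
    filter_upwards [eventually_gt_atTop k.natAbs] with N hN
    rw [if_neg]
    rw [Int.abs_eq_natAbs]
    omega
  · split_ifs <;> simp

/-- The integers that are not an index of a matrix of size `n`. -/
def outside (n : ℕ) (k : ℤ) : Prop := ¬ (0 ≤ k ∧ k < n)

-- An index k < 0 lies at distance at least i + 1 from i, and an index k ≥ n at distance at least n
-- - i.
open Classical in
theorem tsum_outside_le (ht : Summable fun k => |t k|) (n : ℕ) (i : Fin n) :
    (∑' k : ℤ, if outside n k then |t ((i : ℕ) - k)| else 0)
      ≤ tailMass t (i + 1) + tailMass t (n - i) := by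
  have hi := i.2
  have h1 := summable_tailMass ht ((i : ℕ) + 1)
  have h2 := summable_tailMass ht (n - (i : ℕ))
  let e : ℤ ≃ ℤ := Equiv.subLeft ((i : ℕ) : ℤ)
  rw [tailMass, tailMass, ← h1.tsum_add h2, ← e.tsum_eq (fun k : ℤ =>
    (if (((i : ℕ) + 1 : ℕ) : ℤ) ≤ |k| then |t k| else 0)
      + if ((n - (i : ℕ) : ℕ) : ℤ) ≤ |k| then |t k| else 0)]
  have hle : ∀ k : ℤ, (if outside n k then |t ((i : ℕ) - k)| else 0) ≤
      (if (((i : ℕ) + 1 : ℕ) : ℤ) ≤ |e k| then |t (e k)| else 0)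
      + if ((n - (i : ℕ) : ℕ) : ℤ) ≤ |e k| then |t (e k)| else 0 := fun k => by
    have hek : e k = (i : ℕ) - k := rfl
    rw [hek]
    have h0 := abs_nonneg (t ((i : ℕ) - k))
    by_cases ho : outside n k
    · rw [if_pos ho]
      have : (((i : ℕ) + 1 : ℕ) : ℤ) ≤ |((i : ℕ) : ℤ) - k| ∨
          ((n - (i : ℕ) : ℕ) : ℤ) ≤ |((i : ℕ) : ℤ) - k| := by
        unfold outside at ho
        rw [Int.abs_eq_natAbs]
        omega
      rcases this with h | h
      · rw [if_pos h]
        split_ifs <;> linarith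
      · rw [if_pos h]
        split_ifs <;> linarith
    · rw [if_neg ho]
      split_ifs <;> linarith
  have hs := (e.summable_iff.2 (h1.add h2))
  exact Summable.tsum_le_tsum hle
    (Summable.of_nonneg_of_le (fun k => by split_ifs <;> positivity) hle hs) hs

open Classical in
/-- The entrywise `ℓ¹` distance between `T_n(f)^q` and the Toeplitz matrix of `f^q` is `o(n)`. -/
theorem tendsto_toeplitz_pow_sub (ht : Summable fun k => |t k|) (he : ∀ k, t (-k) = t k) (q : ℕ) :
    Tendsto (fun n : ℕ => (n : ℝ)⁻¹ *
      ∑ i, ∑ j, |(toeplitz t n ^ q) i j - toeplitz (fourierMoment t q) n i j|) atTop (𝓝 0) := by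
  induction q with
  | zero =>
    refine tendsto_const_nhds.congr fun n => ?_
    have : ∀ i j : Fin n, (toeplitz t n ^ 0) i j - toeplitz (fourierMoment t 0) n i j = 0 := by
      intro i j
      simp only [toeplitz, pow_zero, Matrix.one_apply, Matrix.of_apply, fourierMoment_zero,
        sub_eq_zero, Nat.cast_inj, Fin.ext_iff]
    rw [Finset.sum_congr rfl fun i _ => Finset.sum_congr rfl fun j _ => by rw [this i j, abs_zero]]
    simp
  | succ q ih =>
    set B := ∑' k, |t k|
    have hm := summable_fourierMoment ht he q
    set K := ∑' k, |fourierMoment t q k|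
    have hB : 0 ≤ B := tsum_nonneg fun _ => abs_nonneg _
    have hK : 0 ≤ K := tsum_nonneg fun _ => abs_nonneg _
    -- One more factor T multiplies the old error by at most the column mass B; the new error comes
    -- from convolution indices outside the matrix.
    have hstep : ∀ n : ℕ,
        ∑ i, ∑ j, |(toeplitz t n ^ (q + 1)) i j - toeplitz (fourierMoment t (q + 1)) n i j|
        ≤ B * ∑ i, ∑ j, |(toeplitz t n ^ q) i j - toeplitz (fourierMoment t q) n i j|
          + K * (2 * ∑ i ∈ Finset.range n, tailMass t (i + 1)) := by
      intro n
      set E : Matrix (Fin n) (Fin n) ℝ := toeplitz t n ^ q - toeplitz (fourierMoment t q) n with hE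
      let ext : Fin n → Fin n → ℝ := fun i j =>
        ∑' k : ℤ, if outside n k then
          |t ((i : ℕ) - k)| * |fourierMoment t q (k - (j : ℕ))| else 0
      have hsum : ∀ i j : Fin n, Summable fun k : ℤ =>
          t ((i : ℕ) - k) * fourierMoment t q (k - (j : ℕ)) := fun i j => by
        refine Summable.of_norm_bounded (g := fun k : ℤ => B * |fourierMoment t q (k - (j : ℕ))|)
          (((Equiv.subRight ((j : ℕ) : ℤ)).summable_iff.2 hm).mul_left B) fun k => ?_
        rw [norm_mul]
        exact mul_le_mul_of_nonneg_right (ht.le_tsum _ fun _ _ => abs_nonneg _) (abs_nonneg _)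
      have hentry : ∀ i j : Fin n,
          |(toeplitz t n ^ (q + 1)) i j - toeplitz (fourierMoment t (q + 1)) n i j|
          ≤ ∑ k, |toeplitz t n i k| * |E k j| + ext i j := by
        intro i j
        have hconv : toeplitz (fourierMoment t (q + 1)) n i j
            = ∑' k : ℤ, t ((i : ℕ) - k) * fourierMoment t q (k - (j : ℕ)) := by
          simp only [toeplitz, Matrix.of_apply]
          rw [fourierMoment_succ ht he,
            ← (Equiv.subRight ((j : ℕ) : ℤ)).tsum_eq fun k : ℤ =>
              t ((i : ℕ) - (j : ℕ) - k) * fourierMoment t q k]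
          simp
        have hinner : ∑ k : Fin n, t ((i : ℕ) - (k : ℕ)) * fourierMoment t q ((k : ℕ) - (j : ℕ))
            = ∑' k : ℤ, if outside n k then 0 else
                t ((i : ℕ) - k) * fourierMoment t q (k - (j : ℕ)) := by
          rw [tsum_eq_sum (s := Finset.univ.map
            ⟨fun k : Fin n => ((k : ℕ) : ℤ), fun a b h => by simpa [Fin.ext_iff] using h⟩)]
          · rw [Finset.sum_map]
            refine Finset.sum_congr rfl fun k _ => ?_
            rw [if_neg]
            · rfl
            · exact not_not.2 ⟨Int.natCast_nonneg _, Int.ofNat_lt.2 k.2⟩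
          · intro k hk
            rw [if_pos]
            rintro ⟨h0, h1⟩
            refine hk (Finset.mem_map.2 ⟨⟨k.toNat, by omega⟩, Finset.mem_univ _, ?_⟩)
            exact Int.toNat_of_nonneg h0
        have hsin : Summable fun k : ℤ => if outside n k then 0 else
                t ((i : ℕ) - k) * fourierMoment t q (k - (j : ℕ)) :=
          Summable.of_norm_bounded (hsum i j).norm fun k => by
            split_ifs <;> simp [mul_nonneg]
        have hsout : Summable fun k : ℤ => if outside n k then
                |t ((i : ℕ) - k)| * |fourierMoment t q (k - (j : ℕ))| else 0 :=
          Summable.of_norm_bounded (hsum i j).norm fun k => by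
            split_ifs <;> simp [mul_nonneg]
        -- The in-range part of the full convolution is T times the Toeplitz matrix of f^q;
        -- subtracting it from T · T^q leaves T · E, and only the out-of-range terms remain
        -- uncompensated.
        have hdiff : (toeplitz t n ^ (q + 1)) i j - toeplitz (fourierMoment t (q + 1)) n i j
            = ∑ k, toeplitz t n i k * E k j +
              ((∑' k : ℤ, if outside n k then 0 else
                t ((i : ℕ) - k) * fourierMoment t q (k - (j : ℕ)))
              - ∑' k : ℤ, t ((i : ℕ) - k) * fourierMoment t q (k - (j : ℕ))) := by
          rw [← hinner, hconv, pow_succ', Matrix.mul_apply, ← add_sub_assoc,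
            ← Finset.sum_add_distrib]
          congr 1
          refine Finset.sum_congr rfl fun k _ => ?_
          simp only [hE, Matrix.sub_apply, toeplitz, Matrix.of_apply]
          ring
        rw [hdiff, ← hsin.tsum_sub (hsum i j)]
        refine (abs_add_le _ _).trans (add_le_add ?_ ?_)
        · refine (Finset.abs_sum_le_sum_abs _ _).trans (le_of_eq ?_)
          simp [abs_mul]
        · refine abs_tsum_le hsout fun k => ?_
          split_ifs <;> simp [abs_mul]
      have hext : ∀ i : Fin n, ∑ j, ext i j
          ≤ K * (tailMass t (i + 1) + tailMass t (n - i)) := by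
        intro i
        have hs : ∀ j ∈ Finset.univ, Summable fun k : ℤ => if outside n k then
                |t ((i : ℕ) - k)| * |fourierMoment t q (k - (j : Fin n))| else 0 := fun j _ =>
          Summable.of_norm_bounded (hsum i j).norm fun k => by
            split_ifs <;> simp [mul_nonneg]
        have hs2 : Summable fun k : ℤ => if outside n k then |t ((i : ℕ) - k)| else 0 := by
          refine Summable.of_nonneg_of_le (fun k => by split_ifs <;> positivity)
            (fun k => ?_) ((Equiv.subLeft ((i : ℕ) : ℤ)).summable_iff.2 ht)
          simp only [Function.comp, Equiv.subLeft_apply]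
          split_ifs <;> simp
        calc ∑ j, ext i j
            = ∑' k : ℤ, ∑ j : Fin n, (if outside n k then
                |t ((i : ℕ) - k)| * |fourierMoment t q (k - (j : ℕ))| else 0) :=
              (Summable.tsum_finsetSum hs).symm
          _ ≤ ∑' k : ℤ, K * (if outside n k then |t ((i : ℕ) - k)| else 0) := by
              refine Summable.tsum_le_tsum (fun k => ?_) (summable_sum hs) (hs2.mul_left _)
              split_ifs
              · rw [← Finset.mul_sum, mul_comm]
                exact mul_le_mul_of_nonneg_right (sum_int_le_tsum hm (fun _ => abs_nonneg _)
                  (fun j : Fin n => k - ((j : ℕ) : ℤ))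
                  fun a b h => by simpa [Fin.ext_iff] using h) (abs_nonneg _)
              · simp
          _ = K * ∑' k : ℤ, (if outside n k then |t ((i : ℕ) - k)| else 0) := tsum_mul_left
          _ ≤ _ := mul_le_mul_of_nonneg_left (tsum_outside_le ht n i) hK
      calc ∑ i, ∑ j, |(toeplitz t n ^ (q + 1)) i j - toeplitz (fourierMoment t (q + 1)) n i j|
          ≤ ∑ i, ∑ j, (∑ k, |toeplitz t n i k| * |E k j| + ext i j) :=
            Finset.sum_le_sum fun i _ => Finset.sum_le_sum fun j _ => hentry i j
        _ = ∑ k, ∑ j, (∑ i, |toeplitz t n i k|) * |E k j| + ∑ i, ∑ j, ext i j := by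
            simp_rw [Finset.sum_add_distrib]
            congr 1
            simp_rw [Finset.sum_mul]
            calc _ = ∑ i, ∑ k, ∑ j, |toeplitz t n i k| * |E k j| :=
                  Finset.sum_congr rfl fun i _ => Finset.sum_comm
              _ = ∑ k, ∑ i, ∑ j, |toeplitz t n i k| * |E k j| := Finset.sum_comm
              _ = _ := Finset.sum_congr rfl fun i _ => Finset.sum_comm
        _ ≤ ∑ k, ∑ j, B * |E k j|
              + ∑ i : Fin n, K * (tailMass t (i + 1) + tailMass t (n - i)) := by
            refine add_le_add (Finset.sum_le_sum fun k _ => Finset.sum_le_sum fun j _ => ?_)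
              (Finset.sum_le_sum fun i _ => hext i)
            exact mul_le_mul_of_nonneg_right (toeplitz_sum_col_le ht n k) (abs_nonneg _)
        _ = _ := by
            simp_rw [← Finset.mul_sum]
            congr 2
            -- The reflection i ↦ n - 1 - i exchanges the distances i + 1 and n - i to the two
            -- borders, so both tail sums agree.
            rw [Finset.sum_add_distrib, two_mul,
              Fin.sum_univ_eq_sum_range (fun i => tailMass t (i + 1)) n,
              Fin.sum_univ_eq_sum_range (fun i => tailMass t (n - i)) n,
              ← Finset.sum_range_reflect (fun i => tailMass t (i + 1)) n]
            congr 1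
            refine Finset.sum_congr rfl fun i hi => ?_
            have := Finset.mem_range.1 hi
            congr 1
            omega
    -- The average of the first n tails tends to 0 because the tails themselves do.
    have hces := ((tendsto_tailMass ht).comp (tendsto_add_atTop_nat 1)).cesaro
    have hlim := (ih.const_mul B).add ((hces.const_mul 2).const_mul K)
    simp only [mul_zero, add_zero] at hlim
    refine squeeze_zero (fun n => by positivity) (fun n => ?_) hlim
    refine (mul_le_mul_of_nonneg_left (hstep n) (by positivity)).trans (le_of_eq ?_)
    simp only [Function.comp]
    ring

/-- The Toeplitz matrix of f^q has constant diagonal `fourierMoment t q 0`, and the diagonal error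
is part of the entrywise ℓ¹ error. -/
theorem tendsto_trace_toeplitz_pow (ht : Summable fun k => |t k|) (he : ∀ k, t (-k) = t k)
    (q : ℕ) : Tendsto (fun n : ℕ => (n : ℝ)⁻¹ * (toeplitz t n ^ q).trace) atTop
      (𝓝 (fourierMoment t q 0)) := by
  rw [tendsto_iff_norm_sub_tendsto_zero]
  refine squeeze_zero' (Eventually.of_forall fun _ => norm_nonneg _) ?_
    (tendsto_toeplitz_pow_sub ht he q)
  filter_upwards [eventually_gt_atTop 0] with n hn
  have hn' : (0 : ℝ) < n := by exact_mod_cast hn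
  have h1 : (n : ℝ)⁻¹ * (toeplitz t n ^ q).trace - fourierMoment t q 0
      = (n : ℝ)⁻¹ * ∑ i, ((toeplitz t n ^ q) i i - toeplitz (fourierMoment t q) n i i) := by
    rw [Finset.sum_sub_distrib, mul_sub]
    simp only [toeplitz, Matrix.of_apply, sub_self, Finset.sum_const, Finset.card_univ,
      Fintype.card_fin, nsmul_eq_mul, Matrix.trace, Matrix.diag]
    field_simp
  rw [h1, norm_mul, Real.norm_eq_abs, abs_of_nonneg (by positivity)]
  refine mul_le_mul_of_nonneg_left ?_ (by positivity)
  refine (norm_sum_le _ _).trans (Finset.sum_le_sum fun i _ => ?_)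
  exact Finset.single_le_sum
    (f := fun j => |(toeplitz t n ^ q) i j - toeplitz (fourierMoment t q) n i j|)
    (fun j _ => abs_nonneg _) (Finset.mem_univ i)

end Toeplitz

/-! ### Eigenvalues of real symmetric matrices: traces, complex characteristic roots, size. -/

section Eigenvalues

variable {ι : Type*} [Fintype ι] [DecidableEq ι] {A : Matrix ι ι ℝ}

theorem trace_pow_eq_sum_eigenvalues (hA : A.IsHermitian) (q : ℕ) :
    (A ^ q).trace = ∑ i, hA.eigenvalues i ^ q := by
  conv_lhs => rw [hA.spectral_theorem, ← map_pow, Unitary.conjStarAlgAut_apply,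
    Matrix.trace_mul_comm, ← mul_assoc]
  simp [Matrix.diagonal_pow, Matrix.trace]

theorem sum_roots_charpoly_map_ofReal (hA : A.IsHermitian) (F : ℂ → ℂ) :
    ((A.map ((↑) : ℝ → ℂ)).charpoly.roots.map F).sum = ∑ i, F (hA.eigenvalues i) := by
  have h : (A.map ((↑) : ℝ → ℂ)).charpoly = A.charpoly.map Complex.ofRealHom :=
    A.charpoly_map Complex.ofRealHom
  rw [h, hA.splits_charpoly.roots_map, hA.roots_charpoly_eq_eigenvalues]
  rw [Multiset.map_map, Multiset.map_map]
  rfl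

theorem sum_abs_one_row (i : ι) : ∑ j, |(1 : Matrix ι ι ℝ) i j| = 1 := by
  rw [Finset.sum_eq_single i]
  · simp
  · intro j _ hj
    simp [Matrix.one_apply_ne hj.symm]
  · simp

/-- Gershgorin: the eigenvalue lies within Σ_{j ≠ k} |A k j| of some A k k, hence within the full
row sum of 0. -/
theorem abs_eigenvalues_le (hA : A.IsHermitian) {R : ℝ} (hR : ∀ i, ∑ j, |A i j| ≤ R) (i : ι) :
    |hA.eigenvalues i| ≤ R := by
  have hv : (hA.eigenvectorBasis i).ofLp ≠ 0 := fun h =>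
    hA.eigenvectorBasis.orthonormal.ne_zero i (by ext j; simpa using congrFun h j)
  have he : Module.End.HasEigenvalue (Matrix.toLin' A) (hA.eigenvalues i) :=
    Module.End.hasEigenvalue_of_hasEigenvector (x := (hA.eigenvectorBasis i).ofLp)
      ⟨Module.End.mem_eigenspace_iff.2 (by
        rw [Matrix.toLin'_apply, hA.mulVec_eigenvectorBasis]), hv⟩
  obtain ⟨k, hk⟩ := eigenvalue_mem_ball he
  rw [Metric.mem_closedBall, Real.dist_eq] at hk
  have h1 := hR k
  rw [← Finset.add_sum_erase _ _ (Finset.mem_univ k)] at h1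
  simp only [Real.norm_eq_abs] at hk
  have h2 := abs_sub_abs_le_abs_sub (hA.eigenvalues i) (A k k)
  linarith

end Eigenvalues

/-! ### The method of moments. -/

section Distribution

variable {X : Type*} [MeasureTheory.MeasureSpace X]
  {ι : ℕ → Type*} [∀ n, Fintype (ι n)] [∀ n, DecidableEq (ι n)] {D : Set X}

theorem integrableOn_of_abs_le {f : X → ℝ} {R : ℝ} (hD' : MeasureTheory.volume D < ⊤)
    (hf : Measurable f) (hfR : ∀ x, |f x| ≤ R) : MeasureTheory.IntegrableOn f D :=
  MeasureTheory.Measure.integrableOn_of_bounded (M := R) hD'.ne hf.aestronglyMeasurable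
    (Eventually.of_forall hfR)

theorem exists_forall_abs_le {g : ℝ → ℝ} (hg : Continuous g) (R : ℝ) :
    ∃ C, ∀ x, |x| ≤ R → |g x| ≤ C := by
  obtain ⟨C, hC⟩ := isCompact_Icc.exists_bound_of_continuousOn (s := Set.Icc (-R) R) hg.continuousOn
  exact ⟨C, fun x hx => hC x (abs_le.1 hx)⟩

theorem integrableOn_comp {g : ℝ → ℝ} {f : X → ℝ} {R : ℝ} (hg : Continuous g)
    (hD' : MeasureTheory.volume D < ⊤) (hf : Measurable f) (hfR : ∀ x, |f x| ≤ R) :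
    MeasureTheory.IntegrableOn (fun t => g (f t)) D := by
  obtain ⟨C, hC⟩ := exists_forall_abs_le hg R
  exact integrableOn_of_abs_le hD' (hg.measurable.comp hf) fun x => hC _ (hfR x)

/-- Convergence of the empirical means of all monomials implies convergence of the empirical means
of all continuous functions, if everything takes place in a fixed bounded interval. -/
theorem tendsto_mean_of_moments {ι : ℕ → Type*} [∀ n, Fintype (ι n)] {v : ∀ n, ι n → ℝ}
    {f : X → ℝ} {R : ℝ}
    (hv : ∀ n i, |v n i| ≤ R) (hD' : MeasureTheory.volume D < ⊤) (hf : Measurable f)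
    (hfR : ∀ x, |f x| ≤ R)
    (hmom : ∀ q : ℕ, Tendsto (fun n => (Fintype.card (ι n) : ℝ)⁻¹ * ∑ i, v n i ^ q) atTop
      (𝓝 ((MeasureTheory.volume D).toReal⁻¹ * ∫ t in D, f t ^ q)))
    {g : ℝ → ℝ} (hg : Continuous g) :
    Tendsto (fun n => (Fintype.card (ι n) : ℝ)⁻¹ * ∑ i, g (v n i)) atTop
      (𝓝 ((MeasureTheory.volume D).toReal⁻¹ * ∫ t in D, g (f t))) := by
  have hpoly : ∀ p : Polynomial ℝ,
      Tendsto (fun n => (Fintype.card (ι n) : ℝ)⁻¹ * ∑ i, p.eval (v n i)) atTop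
      (𝓝 ((MeasureTheory.volume D).toReal⁻¹ * ∫ t in D, p.eval (f t))) := by
    intro p
    induction p using Polynomial.induction_on' with
    | add p r hp hr =>
      simp only [Polynomial.eval_add, Finset.sum_add_distrib, mul_add]
      rw [MeasureTheory.integral_add (integrableOn_comp p.continuous hD' hf hfR)
        (integrableOn_comp r.continuous hD' hf hfR), mul_add]
      exact hp.add hr
    | monomial q a =>
      simp only [Polynomial.eval_monomial, ← Finset.mul_sum]
      rw [MeasureTheory.integral_const_mul, mul_left_comm]
      simp_rw [mul_left_comm _ a]
      exact (hmom q).const_mul a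
  rw [Metric.tendsto_atTop]
  intro ε hε
  -- A polynomial uniformly ε/3-close on [-R, R] changes each of the two means by at most ε/3.
  obtain ⟨p, hp⟩ := exists_polynomial_near_of_continuousOn (-R) R g hg.continuousOn (ε / 3)
    (by positivity)
  obtain ⟨N, hN⟩ := Metric.tendsto_atTop.1 (hpoly p) (ε / 3) (by positivity)
  refine ⟨N, fun n hn => ?_⟩
  have h1 := hN n hn
  have h2 : |(Fintype.card (ι n) : ℝ)⁻¹ * ∑ i, g (v n i)
      - (Fintype.card (ι n) : ℝ)⁻¹ * ∑ i, p.eval (v n i)| ≤ ε / 3 := by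
    rw [← mul_sub, ← Finset.sum_sub_distrib, abs_mul, abs_of_nonneg (by positivity)]
    calc (Fintype.card (ι n) : ℝ)⁻¹ * |∑ i, (g (v n i) - p.eval (v n i))|
        ≤ (Fintype.card (ι n) : ℝ)⁻¹ * ∑ _i : ι n, ε / 3 := by
          gcongr
          refine (Finset.abs_sum_le_sum_abs _ _).trans (Finset.sum_le_sum fun i _ => ?_)
          rw [abs_sub_comm]
          exact (hp _ (abs_le.1 (hv n i))).le
      _ = ((Fintype.card (ι n) : ℝ)⁻¹ * Fintype.card (ι n)) * (ε / 3) := by simp [mul_assoc]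
      -- An inequality rather than an equality: the index type may be empty, and then the
      -- normalising factor is 0.
      _ ≤ 1 * (ε / 3) := by
          gcongr
          exact inv_mul_le_one
      _ = ε / 3 := one_mul _
  have h3 : |(MeasureTheory.volume D).toReal⁻¹ * (∫ t in D, p.eval (f t))
      - (MeasureTheory.volume D).toReal⁻¹ * ∫ t in D, g (f t)| ≤ ε / 3 := by
    rw [← mul_sub, ← MeasureTheory.integral_sub (integrableOn_comp p.continuous hD' hf hfR)
      (integrableOn_comp hg hD' hf hfR), abs_mul, abs_of_nonneg (by positivity)]
    have := MeasureTheory.norm_setIntegral_le_of_norm_le_const (C := ε / 3)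
      (f := fun t => p.eval (f t) - g (f t)) hD' fun x _ => (hp _ (abs_le.1 (hfR x))).le
    calc (MeasureTheory.volume D).toReal⁻¹ * |∫ t in D, (p.eval (f t) - g (f t))|
        ≤ (MeasureTheory.volume D).toReal⁻¹ * (ε / 3 * (MeasureTheory.volume D).toReal) := by
          gcongr
          exact this
      _ = ((MeasureTheory.volume D).toReal⁻¹ * (MeasureTheory.volume D).toReal) * (ε / 3) := by
          ring
      _ ≤ 1 * (ε / 3) := by
          gcongr
          exact inv_mul_le_one
      _ = ε / 3 := one_mul _
  rw [Real.dist_eq] at h1 ⊢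
  have := abs_le.1 h2
  have := abs_le.1 h3
  have := abs_lt.1 h1
  rw [abs_lt]
  constructor <;> linarith

/-- The eigenvalues are real, so only the restriction of F to the real line matters; its real and
imaginary parts are handled separately by `tendsto_mean_of_moments`. -/
theorem eigDistributed_of_moments {A : ∀ n, Matrix (ι n) (ι n) ℝ} {f : X → ℝ} {R : ℝ}
    (hA : ∀ n, (A n).IsHermitian) (hAR : ∀ n i, ∑ j, |A n i j| ≤ R)
    (hD : MeasurableSet D) (hD0 : 0 < MeasureTheory.volume D)
    (hD' : MeasureTheory.volume D < ⊤) (hf : Measurable f) (hfR : ∀ x, |f x| ≤ R)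
    (hmom : ∀ q : ℕ, Tendsto (fun n => (Fintype.card (ι n) : ℝ)⁻¹ * (A n ^ q).trace) atTop
      (𝓝 ((MeasureTheory.volume D).toReal⁻¹ * ∫ t in D, f t ^ q))) :
    EigDistributed (fun n => (A n).map ((↑) : ℝ → ℂ)) (fun x => (f x : ℂ)) D where
  measurableSet := hD
  volume_pos := hD0
  volume_lt_top := hD'
  measurable := (Complex.measurable_ofReal.comp hf).comp measurable_subtype_coe
  tendsto := by
    intro F hF _
    simp_rw [trace_pow_eq_sum_eigenvalues (hA _)] at hmom
    have key := fun g : ℝ → ℝ => fun hg : Continuous g =>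
      tendsto_mean_of_moments (fun n => abs_eigenvalues_le (hA n) (hAR n)) hD' hf hfR hmom hg
    have hre := key (fun x => (F x).re) (by fun_prop)
    have him := key (fun x => (F x).im) (by fun_prop)
    have hlim := ((Complex.continuous_ofReal.tendsto _).comp hre).add
      (((Complex.continuous_ofReal.tendsto _).comp him).mul_const Complex.I)
    have hint : MeasureTheory.IntegrableOn (fun t => F (f t)) D := by
      obtain ⟨C, hC⟩ := isCompact_Icc.exists_bound_of_continuousOn (s := Set.Icc (-R) R)
        (f := fun x : ℝ => F x) (by fun_prop)
      exact MeasureTheory.Measure.integrableOn_of_bounded (M := C) hD'.ne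
        (hF.measurable.comp (Complex.measurable_ofReal.comp hf)).aestronglyMeasurable
        (Eventually.of_forall fun x => hC _ (abs_le.1 (hfR x)))
    have hI := integral_re_add_im hint
    simp only [RCLike.re_to_complex, RCLike.im_to_complex, RCLike.I_to_complex,
      Complex.coe_algebraMap] at hI
    convert hlim using 1
    · funext n
      rw [sum_roots_charpoly_map_ofReal (hA n)]
      simp only [Function.comp]
      push_cast
      rw [mul_assoc, ← mul_add, Finset.sum_mul, ← Finset.sum_add_distrib, one_div]
      simp only [Complex.re_add_im]
    · rw [← hI]
      push_cast
      rw [mul_assoc, ← mul_add, one_div]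

/-- Linear combinations, with convergent coefficients, of the identity and of two commuting
sequences of symmetric matrices whose mixed moments converge. -/
theorem eigDistributed_combination {P Q : ∀ n, Matrix (ι n) (ι n) ℝ} {u v : X → ℝ} {B : ℝ}
    (hP : ∀ n, (P n).IsHermitian) (hQ : ∀ n, (Q n).IsHermitian)
    (hPQ : ∀ n, Commute (P n) (Q n))
    (hPB : ∀ n i, ∑ j, |P n i j| ≤ B) (hQB : ∀ n i, ∑ j, |Q n i j| ≤ B)
    (hD : MeasurableSet D) (hD0 : 0 < MeasureTheory.volume D)
    (hD' : MeasureTheory.volume D < ⊤) (hu : Measurable u) (hv : Measurable v)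
    (huB : ∀ x, |u x| ≤ B) (hvB : ∀ x, |v x| ≤ B)
    (hmom : ∀ a b : ℕ,
      Tendsto (fun n => (Fintype.card (ι n) : ℝ)⁻¹ * (P n ^ a * Q n ^ b).trace) atTop
        (𝓝 ((MeasureTheory.volume D).toReal⁻¹ * ∫ t in D, u t ^ a * v t ^ b)))
    {x y z : ℕ → ℝ} {x₀ y₀ z₀ : ℝ} (hx : Tendsto x atTop (𝓝 x₀)) (hy : Tendsto y atTop (𝓝 y₀))
    (hz : Tendsto z atTop (𝓝 z₀)) :
    EigDistributed
      (fun n => (x n • (1 : Matrix (ι n) (ι n) ℝ) + (y n • P n + z n • Q n)).map ((↑) : ℝ → ℂ))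
      (fun t => ((x₀ + (y₀ * u t + z₀ * v t) : ℝ) : ℂ)) D := by
  have hlim : Tendsto (fun n => |x n| + (|y n| * B + |z n| * B)) atTop
      (𝓝 (|x₀| + (|y₀| * B + |z₀| * B))) :=
    hx.abs.add ((hy.abs.mul_const B).add (hz.abs.mul_const B))
  -- Convergent scalars are bounded, which gives one R for all the row sums; passing to the limit,
  -- the same R bounds the limit function.
  obtain ⟨R, hR⟩ := hlim.bddAbove_range
  have hR' : ∀ n, |x n| + (|y n| * B + |z n| * B) ≤ R := fun n => hR ⟨n, rfl⟩
  refine eigDistributed_of_moments (R := R) (fun n => ?_) (fun n i => ?_) hD hD0 hD'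
    (by fun_prop) (fun t => ?_) fun q => ?_
  · have h1 : (1 : Matrix (ι n) (ι n) ℝ).IsHermitian := Matrix.isHermitian_one
    refine Matrix.IsHermitian.add ?_ (Matrix.IsHermitian.add ?_ ?_)
    · exact IsSelfAdjoint.smul (IsSelfAdjoint.all _) h1
    · exact IsSelfAdjoint.smul (IsSelfAdjoint.all _) (hP n)
    · exact IsSelfAdjoint.smul (IsSelfAdjoint.all _) (hQ n)
  · refine le_trans ?_ (hR' n)
    calc ∑ j, |(x n • (1 : Matrix (ι n) (ι n) ℝ) + (y n • P n + z n • Q n)) i j|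
        ≤ ∑ j, (|x n| * |(1 : Matrix (ι n) (ι n) ℝ) i j|
            + (|y n| * |P n i j| + |z n| * |Q n i j|)) := by
          refine Finset.sum_le_sum fun j _ => ?_
          simp only [Matrix.add_apply, Matrix.smul_apply, smul_eq_mul, ← abs_mul]
          exact (abs_add_le _ _).trans (add_le_add_right (abs_add_le _ _) _)
      _ = |x n| * 1 + (|y n| * ∑ j, |P n i j| + |z n| * ∑ j, |Q n i j|) := by
          rw [Finset.sum_add_distrib, Finset.sum_add_distrib, ← Finset.mul_sum, ← Finset.mul_sum,
            ← Finset.mul_sum, sum_abs_one_row]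
      _ ≤ |x n| + (|y n| * B + |z n| * B) := by
          rw [mul_one]
          gcongr
          · exact hPB n i
          · exact hQB n i
  · refine le_trans ?_ (le_of_tendsto' hlim hR')
    refine (abs_add_le _ _).trans (add_le_add_right ((abs_add_le _ _).trans ?_) _)
    rw [abs_mul, abs_mul]
    gcongr
    · exact huB t
    · exact hvB t
  -- All summands commute, so two binomial expansions turn the trace into a finite combination of
  -- mixed moments with convergent coefficients; `hexp'` is the same expansion of the limit.
  · have hexp : ∀ n, (Fintype.card (ι n) : ℝ)⁻¹ *
        ((x n • (1 : Matrix (ι n) (ι n) ℝ) + (y n • P n + z n • Q n)) ^ q).trace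
        = ∑ m ∈ Finset.range (q + 1), ∑ l ∈ Finset.range (q - m + 1),
          (x n ^ m * y n ^ l * z n ^ (q - m - l) * (q.choose m * (q - m).choose l)) *
          ((Fintype.card (ι n) : ℝ)⁻¹ * (P n ^ l * Q n ^ (q - m - l)).trace) := fun n => by
      have hc : Commute (x n • (1 : Matrix (ι n) (ι n) ℝ)) (y n • P n + z n • Q n) :=
        (Commute.one_left _).smul_left _
      have hc' : Commute (y n • P n) (z n • Q n) := ((hPQ n).smul_left _).smul_right _
      rw [hc.add_pow, Matrix.trace_sum, Finset.mul_sum]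
      refine Finset.sum_congr rfl fun m _ => ?_
      rw [hc'.add_pow, Finset.mul_sum, Finset.sum_mul, Matrix.trace_sum, Finset.mul_sum]
      refine Finset.sum_congr rfl fun l _ => ?_
      simp only [smul_pow, one_pow, ← nsmul_eq_mul', Matrix.smul_mul, Matrix.mul_smul,
        Matrix.trace_smul, one_mul]
      simp only [smul_eq_mul, nsmul_eq_mul]
      ring
    have hbu : ∀ l k : ℕ, MeasureTheory.IntegrableOn (fun t => u t ^ l * v t ^ k) D := fun l k =>
      integrableOn_of_abs_le (R := B ^ l * B ^ k) hD' (by fun_prop) fun t => by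
        rw [abs_mul, abs_pow, abs_pow]
        have hB : 0 ≤ B := (abs_nonneg _).trans (huB t)
        gcongr
        · exact huB t
        · exact hvB t
    have hexp' : (MeasureTheory.volume D).toReal⁻¹ *
        ∫ t in D, (x₀ + (y₀ * u t + z₀ * v t)) ^ q
        = ∑ m ∈ Finset.range (q + 1), ∑ l ∈ Finset.range (q - m + 1),
          (x₀ ^ m * y₀ ^ l * z₀ ^ (q - m - l) * (q.choose m * (q - m).choose l)) *
          ((MeasureTheory.volume D).toReal⁻¹ * ∫ t in D, u t ^ l * v t ^ (q - m - l)) := by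
      have h1 : ∀ t, (x₀ + (y₀ * u t + z₀ * v t)) ^ q
          = ∑ m ∈ Finset.range (q + 1), ∑ l ∈ Finset.range (q - m + 1),
          (x₀ ^ m * y₀ ^ l * z₀ ^ (q - m - l) * (q.choose m * (q - m).choose l)) *
            (u t ^ l * v t ^ (q - m - l)) := fun t => by
        rw [add_pow]
        refine Finset.sum_congr rfl fun m _ => ?_
        rw [add_pow, Finset.mul_sum, Finset.sum_mul]
        refine Finset.sum_congr rfl fun l _ => ?_
        rw [mul_pow, mul_pow]
        ring
      simp_rw [h1]
      rw [MeasureTheory.integral_finsetSum _ fun m _ => MeasureTheory.integrable_finsetSum _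
        fun l _ => (hbu _ _).const_mul _, Finset.mul_sum]
      refine Finset.sum_congr rfl fun m _ => ?_
      rw [MeasureTheory.integral_finsetSum _ fun l _ => (hbu _ _).const_mul _, Finset.mul_sum]
      refine Finset.sum_congr rfl fun l _ => ?_
      rw [MeasureTheory.integral_const_mul]
      ring
    simp_rw [hexp]
    rw [hexp']
    exact tendsto_finsetSum _ fun m _ => tendsto_finsetSum _ fun l _ =>
      ((((hx.pow m).mul (hy.pow l)).mul (hz.pow _)).mul_const _).mul (hmom l (q - m - l))

end Distribution

/-! ### The weights, the symbol and its sign. -/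

/-- The weights `ω_k`, extended by zero to negative indices. -/
def intWeight (pq : Shifts) (α : ℝ) (m : ℤ) : ℝ := if 0 ≤ m then weight pq α m.toNat else 0

/-- The Fourier coefficients of the symbol. -/
def symbolCoeff (pq : Shifts) (α : ℝ) (m : ℤ) : ℝ :=
  intWeight pq α (m + 1) + intWeight pq α (1 - m)

theorem intWeight_natCast (pq : Shifts) (α : ℝ) (k : ℕ) : intWeight pq α k = weight pq α k := by
  simp [intWeight]

theorem intWeight_eq_zero_of_notMem_range (pq : Shifts) (α : ℝ) {m : ℤ}
    (hm : m ∉ Set.range ((↑) : ℕ → ℤ)) : intWeight pq α m = 0 :=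
  if_neg fun h => hm ⟨m.toNat, Int.toNat_of_nonneg h⟩

theorem symbolCoeff_neg (pq : Shifts) (α : ℝ) (m : ℤ) :
    symbolCoeff pq α (-m) = symbolCoeff pq α m := by
  rw [symbolCoeff, symbolCoeff, add_comm]
  congr 2 <;> ring

section Weights

variable (pq : Shifts) {α : ℝ}

theorem summable_intWeight (h1 : 1 < α) (h2 : α < 2) : Summable fun m => |intWeight pq α m| := by
  rw [← Nat.cast_injective.summable_iff (g := ((↑) : ℕ → ℤ)) fun m hm => by
    rw [intWeight_eq_zero_of_notMem_range pq α hm, abs_zero]]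
  refine (summable_weight pq h1 h2).congr fun k => ?_
  rw [Function.comp, intWeight_natCast]

theorem summable_symbolCoeff (h1 : 1 < α) (h2 : α < 2) :
    Summable fun m => |symbolCoeff pq α m| := by
  have hw := summable_intWeight pq h1 h2
  exact Summable.of_nonneg_of_le (fun _ => abs_nonneg _) (fun m => abs_add_le _ _)
    (((Equiv.addRight (1 : ℤ)).summable_iff.2 hw).add ((Equiv.subLeft (1 : ℤ)).summable_iff.2 hw))

theorem gMatrix_eq_toeplitz (M : ℕ) : gMatrix pq α M = toeplitz (symbolCoeff pq α) M := by
  have key : ∀ i j : Fin M, hessToeplitz pq α M i j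
      = intWeight pq α ((i : ℕ) - (j : ℕ) + 1) := fun i j => by
    simp only [hessToeplitz, Matrix.of_apply, intWeight]
    by_cases h : (j : ℕ) ≤ i + 1
    · rw [if_pos h, if_pos (by omega)]
      congr 1
      omega
    · rw [if_neg h, if_neg (by omega)]
  ext i j
  rw [gMatrix, Matrix.add_apply, Matrix.transpose_apply, key, key]
  simp only [toeplitz, Matrix.of_apply, symbolCoeff]
  congr 2
  ring

theorem tsum_shift_add_reflect {c : ℤ → ℝ} (hc : Summable c) :
    ∑' m : ℤ, (c (m + 1) + c (1 - m)) = 2 * ∑' k, c k := by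
  have h1 : HasSum (fun m : ℤ => c (m + 1)) (∑' k, c k) :=
    (Equiv.addRight (1 : ℤ)).hasSum_iff.2 hc.hasSum
  have h2 : HasSum (fun m : ℤ => c (1 - m)) (∑' k, c k) :=
    (Equiv.subLeft (1 : ℤ)).hasSum_iff.2 hc.hasSum
  rw [(h1.add h2).tsum_eq, two_mul]

/-- The shift k = m + 1 and the reflection k = 1 - m both turn cos((k - 1)x) into cos(mx), so twice
the one-sided series is the two-sided one with coefficients `symbolCoeff`. -/
theorem symbol_eq_fourierCos (h1 : 1 < α) (h2 : α < 2) :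
    symbol pq α = fourierCos (symbolCoeff pq α) := by
  funext x
  have hcs : Summable fun k : ℤ => intWeight pq α k * Real.cos (((k : ℝ) - 1) * x) :=
    summable_mul_cos (summable_intWeight pq h1 h2) _
  have hnat : ∑' k : ℕ, weight pq α k * Real.cos (((k : ℝ) - 1) * x)
      = ∑' k : ℤ, intWeight pq α k * Real.cos (((k : ℝ) - 1) * x) := by
    rw [← Nat.cast_injective.tsum_eq (g := ((↑) : ℕ → ℤ))]
    · exact tsum_congr fun k => by rw [intWeight_natCast, Int.cast_natCast]
    · intro m hm
      by_contra h
      exact hm (by simp only [intWeight_eq_zero_of_notMem_range pq α h, zero_mul])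
  rw [symbol, hnat, ← tsum_shift_add_reflect hcs, fourierCos]
  refine tsum_congr fun m => ?_
  have e1 : (((m + 1 : ℤ) : ℝ) - 1) * x = m * x := by
    push_cast
    ring
  have e2 : (((1 - m : ℤ) : ℝ) - 1) * x = -(m * x) := by
    push_cast
    ring
  rw [e1, e2, Real.cos_neg, symbolCoeff, add_mul]

/-- By `sum_glCoeff` a partial sum is a nonpositive multiple of the next coefficient, which is
nonnegative from index 2 on. -/
theorem tsum_glCoeff_nonpos (h1 : 1 < α) (h2 : α < 2) : ∑' k, glCoeff α k ≤ 0 := by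
  refine le_of_tendsto ((summable_glCoeff h1 h2).hasSum.tendsto_sum_nat) ?_
  filter_upwards [eventually_ge_atTop 2] with n hn
  obtain ⟨k, rfl⟩ := Nat.exists_eq_add_of_le' hn
  have h := sum_glCoeff (α := α) (k + 1)
  have hg := glCoeff_nonneg h1 h2 k
  have hk : (0 : ℝ) ≤ k := k.cast_nonneg
  refine nonpos_of_mul_nonpos_left (b := α) ?_ (by linarith)
  rw [h]
  push_cast
  nlinarith [mul_nonneg hk hg]

/-- The weights combine two shifted copies of `glCoeff` with coefficients adding to 1: α/2 + (2 -
α)/2, respectively (α + 2)/4 + (2 - α)/4. -/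
theorem tsum_weight_eq (h1 : 1 < α) (h2 : α < 2) : ∑' k, weight pq α k = ∑' k, glCoeff α k := by
  have hg := summable_glCoeff h1 h2
  have hg1 := (summable_nat_add_iff 1).2 hg
  have hg2 := (summable_nat_add_iff 2).2 hg
  have hw := (summable_weight pq h1 h2).of_abs
  have e1 := hg.sum_add_tsum_nat_add 1
  have e2 := hg.sum_add_tsum_nat_add 2
  cases pq with
  | oneZero =>
    rw [← hw.sum_add_tsum_nat_add 1]
    simp only [Finset.sum_range_succ, Finset.sum_range_zero, weight] at e1 ⊢
    rw [(hg1.mul_left _).tsum_add (hg.mul_left _), tsum_mul_left, tsum_mul_left]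
    linear_combination (α / 2) * e1
  | oneNegOne =>
    rw [← hw.sum_add_tsum_nat_add 2]
    simp only [Finset.sum_range_succ, Finset.sum_range_zero, weight] at e2 ⊢
    rw [(hg2.mul_left _).tsum_add (hg.mul_left _), tsum_mul_left, tsum_mul_left]
    linear_combination ((α + 2) / 4) * e2

/-- From index 4 on, for both shift pairs, only the nonnegative coefficients g_k with k ≥ 2 enter.
-/
theorem weight_add_four_nonneg (h1 : 1 < α) (h2 : α < 2) (k : ℕ) : 0 ≤ weight pq α (k + 4) := by
  have g4 := glCoeff_nonneg h1 h2 (k + 2)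
  have g3 := glCoeff_nonneg h1 h2 (k + 1)
  have g2 := glCoeff_nonneg h1 h2 k
  cases pq with
  | oneZero =>
    simp only [weight]
    exact add_nonneg (mul_nonneg (by linarith) g4) (mul_nonneg (by linarith) g3)
  | oneNegOne =>
    simp only [weight]
    exact add_nonneg (mul_nonneg (by linarith) g4) (mul_nonneg (by linarith) g2)

theorem weight_zero_add_weight_two_nonneg (h1 : 1 < α) (h2 : α < 2) :
    0 ≤ weight pq α 0 + weight pq α 2 := by
  cases pq with
  | oneZero =>
    have : weight .oneZero α 0 + weight .oneZero α 2 = α * (α - 1) * (α + 2) / 4 := by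
      simp only [weight, glCoeff]
      push_cast
      ring
    rw [this]
    have := mul_nonneg (mul_nonneg (by linarith : 0 ≤ α) (by linarith : 0 ≤ α - 1))
      (by linarith : 0 ≤ α + 2)
    linarith
  | oneNegOne =>
    have : weight .oneNegOne α 0 + weight .oneNegOne α 2 = 1 + α * (α - 1) * (α + 2) / 8 := by
      simp only [weight, glCoeff]
      push_cast
      ring
    rw [this]
    have := mul_nonneg (mul_nonneg (by linarith : 0 ≤ α) (by linarith : 0 ≤ α - 1))
      (by linarith : 0 ≤ α + 2)
    linarith

/-- With c = cos x, the head in `symbol_nonpos` is (1 - c)(ω₀ + ω₂ + 2(1 + c)ω₃). The second factor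
is affine in c, so it suffices to check c = -1, which gives ω₀ + ω₂, and c = 1, which gives this
expression. For the shifts (1, -1) the weight ω₃ is negative, so an explicit polynomial in α - 1 is
needed. -/
theorem weight_combination_nonneg (h1 : 1 < α) (h2 : α < 2) :
    0 ≤ weight pq α 0 + weight pq α 2 + 4 * weight pq α 3 := by
  cases pq with
  | oneZero =>
    have h3 : 0 ≤ weight .oneZero α 3 :=
      add_nonneg (mul_nonneg (by linarith) (glCoeff_nonneg h1 h2 1))
        (mul_nonneg (by linarith) (glCoeff_nonneg h1 h2 0))
    have := weight_zero_add_weight_two_nonneg .oneZero h1 h2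
    linarith
  | oneNegOne =>
    have : weight .oneNegOne α 0 + weight .oneNegOne α 2 + 4 * weight .oneNegOne α 3
        = (α - 1) * (21 + 40 * (α - 1) - 9 * (α - 1) ^ 2 - 4 * (α - 1) ^ 3) / 24 := by
      simp only [weight, glCoeff]
      push_cast
      ring
    rw [this]
    have hb : 0 ≤ α - 1 := by linarith
    have hb2 : (α - 1) ^ 2 ≤ 1 := pow_le_one₀ hb (by linarith)
    have hb3 : (α - 1) ^ 3 ≤ 1 := pow_le_one₀ hb (by linarith)
    exact div_nonneg (mul_nonneg hb (by linarith)) (by norm_num)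

/-- Writing cos = 1 - (1 - cos) gives f_α/2 = Σ ω_k - Σ ω_k (1 - cos((k - 1)x)). The first sum is
nonpositive; in the second the terms with k ≥ 4 are nonnegative and the four head terms are so
jointly. -/
theorem symbol_nonpos (h1 : 1 < α) (h2 : α < 2) (x : ℝ) : symbol pq α x ≤ 0 := by
  have hw := summable_weight pq h1 h2
  set d : ℕ → ℝ := fun k => weight pq α k * (1 - Real.cos (((k : ℝ) - 1) * x)) with hd
  have hc := summable_mul_cos hw fun k : ℕ => ((k : ℝ) - 1) * x
  have hds : Summable d := (hw.of_abs.sub hc).congr fun k => by simp only [hd]; ring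
  have hsplit : ∑' k : ℕ, weight pq α k * Real.cos (((k : ℝ) - 1) * x)
      = ∑' k, weight pq α k - ∑' k, d k := by
    rw [← hw.of_abs.tsum_sub hds]
    refine tsum_congr fun k => ?_
    simp only [hd]
    ring
  have hsum : ∑' k, weight pq α k ≤ 0 := (tsum_weight_eq pq h1 h2).trans_le
    (tsum_glCoeff_nonpos h1 h2)
  have htail : 0 ≤ ∑' k, d (k + 4) := tsum_nonneg fun k =>
    mul_nonneg (weight_add_four_nonneg pq h1 h2 k) (sub_nonneg.2 (Real.cos_le_one _))
  have hhead : 0 ≤ ∑ k ∈ Finset.range 4, d k := by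
    have e0 : Real.cos ((((0 : ℕ) : ℝ) - 1) * x) = Real.cos x := by
      rw [← Real.cos_neg]
      congr 1
      push_cast
      ring
    have e1 : Real.cos ((((1 : ℕ) : ℝ) - 1) * x) = 1 := by simp
    have e2 : Real.cos ((((2 : ℕ) : ℝ) - 1) * x) = Real.cos x := by
      congr 1
      push_cast
      ring
    have e3 : Real.cos ((((3 : ℕ) : ℝ) - 1) * x) = 2 * Real.cos x ^ 2 - 1 := by
      rw [← Real.cos_two_mul]
      congr 1
      push_cast
      ring
    simp only [Finset.sum_range_succ, Finset.sum_range_zero, hd, e0, e1, e2, e3]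
    have hcl := Real.cos_le_one x
    have hcg := Real.neg_one_le_cos x
    have hA := weight_zero_add_weight_two_nonneg pq h1 h2
    have hB := weight_combination_nonneg pq h1 h2
    -- the head is a convex combination of the two nonnegative quantities `hA` and `hB`
    have := mul_nonneg (sub_nonneg.2 hcl)
      (add_nonneg (mul_nonneg (by linarith : 0 ≤ (1 - Real.cos x) / 2) hA)
        (mul_nonneg (by linarith : 0 ≤ (1 + Real.cos x) / 2) hB))
    linarith
  rw [symbol, hsplit, ← hds.sum_add_tsum_nat_add 4]
  linarith

theorem posSemidef_neg_gMatrix (h1 : 1 < α) (h2 : α < 2) (M : ℕ) :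
    (-gMatrix pq α M).PosSemidef := by
  rw [gMatrix_eq_toeplitz]
  refine posSemidef_neg_toeplitz (summable_symbolCoeff pq h1 h2) (symbolCoeff_neg pq α)
    (fun x => ?_) M
  rw [← symbol_eq_fourierCos pq h1 h2]
  exact symbol_nonpos pq h1 h2 x

theorem gMatrix_isHermitian (M : ℕ) : (gMatrix pq α M).IsHermitian := by
  rw [gMatrix_eq_toeplitz]
  exact toeplitz_isHermitian (symbolCoeff_neg pq α) M

/-- A common bound for the absolute row sums of the matrices `G_{α,M}` and for the symbol. -/
def coeffMass (pq : Shifts) (α : ℝ) : ℝ := ∑' m, |symbolCoeff pq α m|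

theorem gMatrix_sum_row_le (h1 : 1 < α) (h2 : α < 2) (M : ℕ) (i : Fin M) :
    ∑ j, |gMatrix pq α M i j| ≤ coeffMass pq α := by
  rw [gMatrix_eq_toeplitz]
  exact toeplitz_sum_row_le (summable_symbolCoeff pq h1 h2) M i

theorem abs_symbol_le (h1 : 1 < α) (h2 : α < 2) (x : ℝ) : |symbol pq α x| ≤ coeffMass pq α := by
  rw [symbol_eq_fourierCos pq h1 h2]
  exact abs_fourierCos_le (summable_symbolCoeff pq h1 h2) x

theorem continuous_symbol (h1 : 1 < α) (h2 : α < 2) : Continuous (symbol pq α) := by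
  rw [symbol_eq_fourierCos pq h1 h2]
  exact continuous_fourierCos (summable_symbolCoeff pq h1 h2)

theorem tendsto_trace_gMatrix_pow (h1 : 1 < α) (h2 : α < 2) {M : ℕ → ℕ}
    (hM : Tendsto M atTop atTop) (q : ℕ) :
    Tendsto (fun n => (M n : ℝ)⁻¹ * (gMatrix pq α (M n) ^ q).trace) atTop
      (𝓝 ((2 * Real.pi)⁻¹ * ∫ x in Set.Icc (-Real.pi) Real.pi, symbol pq α x ^ q)) := by
  have h := (tendsto_trace_toeplitz_pow (summable_symbolCoeff pq h1 h2) (symbolCoeff_neg pq α)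
    q).comp hM
  rw [fourierMoment, intervalIntegral.integral_of_le (by linarith [Real.pi_pos]),
    ← MeasureTheory.integral_Icc_eq_integral_Ioc, ← symbol_eq_fourierCos pq h1 h2] at h
  simpa [gMatrix_eq_toeplitz, Function.comp_def] using h

end Weights

/-! ### The mesh ratios γ and their comparison. -/

section Ratio

variable {α ht hx : ℝ}

theorem cos_mul_pi_div_two_neg (h1 : 1 < α) (h2 : α < 2) : Real.cos (α * Real.pi / 2) < 0 :=
  Real.cos_neg_of_pi_div_two_lt_of_lt (by nlinarith [Real.pi_pos]) (by nlinarith [Real.pi_pos])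

theorem step_pos {a b : ℝ} (hab : a < b) (M : ℕ) : 0 < step a b M :=
  div_pos (sub_pos.2 hab) (by positivity)

theorem tendsto_step (a b : ℝ) {M : ℕ → ℕ} (hM : Tendsto M atTop atTop) :
    Tendsto (fun n => step a b (M n)) atTop (𝓝 0) :=
  tendsto_const_nhds.div_atTop
    (tendsto_atTop_add_const_right _ _ (tendsto_natCast_atTop_atTop.comp hM))

theorem cBar_pos (h1 : 1 < α) (h2 : α < 2) (hx0 : 0 < hx) : 0 < cBar α hx := by
  have := cos_mul_pi_div_two_neg h1 h2
  exact neg_pos.2 (inv_lt_zero.2 (mul_neg_of_pos_of_neg (by positivity) this))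

theorem gam_eq_mul_cBar (α ht hx : ℝ) : gam α ht hx = ht * cBar α hx := by
  rw [gam, cBar, div_eq_mul_inv]
  ring

theorem gam_pos (h1 : 1 < α) (h2 : α < 2) (hx0 : 0 < hx) (ht0 : 0 < ht) : 0 < gam α ht hx := by
  rw [gam_eq_mul_cBar]
  exact mul_pos ht0 (cBar_pos h1 h2 hx0)

/-- The ratio of the direction with the smaller order is negligible. -/
theorem tendsto_gam_div_gam {α β : ℝ} (hα : 1 < α) (hα' : α < 2) (hβ : 1 < β) (hβ' : β < 2)
    (hβα : β < α) {ht hx hy : ℕ → ℝ} (ht0 : ∀ n, 0 < ht n) (hx0 : ∀ n, 0 < hx n)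
    (hy0 : ∀ n, 0 < hy n) (hxlim : Tendsto hx atTop (𝓝 0)) (hxy : hx =O[atTop] hy) :
    Tendsto (fun n => gam β (ht n) (hy n) / gam α (ht n) (hx n)) atTop (𝓝 0) := by
  have hca := cos_mul_pi_div_two_neg hα hα'
  have hcb := cos_mul_pi_div_two_neg hβ hβ'
  obtain ⟨C, hC⟩ := hxy.bound
  have hpow : Tendsto (fun n => hx n ^ (α - β)) atTop (𝓝 0) := by
    have := hxlim.rpow_const (p := α - β) (Or.inr (by linarith))
    rwa [Real.zero_rpow (by linarith)] at this
  -- The time step cancels; the first power tends to 0 since α > β, and the second is eventually at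
  -- most C^β because hx = O(hy).
  have heq : ∀ n, gam β (ht n) (hy n) / gam α (ht n) (hx n)
      = (Real.cos (α * Real.pi / 2) / Real.cos (β * Real.pi / 2))
        * (hx n ^ (α - β) * (hx n / hy n) ^ β) := fun n => by
    have h1 := Real.rpow_pos_of_pos (hx0 n) α
    have h2 := Real.rpow_pos_of_pos (hy0 n) β
    have h3 := Real.rpow_pos_of_pos (hx0 n) β
    have h4 := ht0 n
    rw [gam, gam, Real.rpow_sub (hx0 n), Real.div_rpow (hx0 n).le (hy0 n).le]
    field_simp
  have hlim : Tendsto (fun n => hx n ^ (α - β) * (hx n / hy n) ^ β) atTop (𝓝 0) := by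
    refine squeeze_zero' (Eventually.of_forall fun n => ?_) ?_
      (by simpa using hpow.mul_const (C ^ β))
    · have := hx0 n
      have := hy0 n
      positivity
    · filter_upwards [hC] with n hn
      rw [Real.norm_of_nonneg (hx0 n).le, Real.norm_of_nonneg (hy0 n).le] at hn
      have h1 := hx0 n
      have h2 := hy0 n
      gcongr
      rwa [div_le_iff₀ h2]
  simp_rw [heq]
  simpa using hlim.const_mul _

end Ratio

/-! ### One space dimension. -/

section OneDimension

theorem posDef_one_add {ι : Type*} [Fintype ι] [DecidableEq ι] {T : Matrix ι ι ℝ} {c d : ℝ}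
    (hc : 0 < c) (hd : 0 ≤ d) (hT : (-T).PosSemidef) :
    (c • (1 : Matrix ι ι ℝ) - d • T).PosDef := by
  rw [sub_eq_add_neg, ← smul_neg]
  exact (Matrix.PosDef.one.smul hc).add_posSemidef (hT.smul hd)

theorem posDef_coeffMatrix (pq : Shifts) {s ε α ht hx : ℝ} (hs : 0 < s) (h1 : 1 < α) (h2 : α < 2)
    (ht0 : 0 < ht) (hx0 : 0 < hx) (M : ℕ) : (coeffMatrix pq s ε α ht hx M).PosDef := by
  have := cBar_pos h1 h2 hx0
  exact posDef_one_add (by positivity) (by positivity) (posSemidef_neg_gMatrix pq h1 h2 M)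

/-- The case Q = 0, v = 0 of `eigDistributed_combination`; mixed moments with b > 0 vanish on both
sides. -/
theorem eigDistributed_one_dim (pq : Shifts) {α : ℝ} (h1 : 1 < α) (h2 : α < 2) {M : ℕ → ℕ}
    (hM : Tendsto M atTop atTop) {x y : ℕ → ℝ} {x₀ y₀ : ℝ} (hx : Tendsto x atTop (𝓝 x₀))
    (hy : Tendsto y atTop (𝓝 y₀)) :
    EigDistributed
      (fun n => (x n • (1 : Matrix (Fin (M n)) (Fin (M n)) ℝ)
        + y n • gMatrix pq α (M n)).map ((↑) : ℝ → ℂ))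
      (fun t => ((x₀ + y₀ * symbol pq α t : ℝ) : ℂ)) (Set.Icc (-Real.pi) Real.pi) := by
  have hpi := Real.pi_pos
  have hvol : (MeasureTheory.volume (Set.Icc (-Real.pi) Real.pi)).toReal = 2 * Real.pi := by
    rw [Real.volume_Icc, ENNReal.toReal_ofReal (by linarith)]
    ring
  have hB : 0 ≤ coeffMass pq α := tsum_nonneg fun _ => abs_nonneg _
  have := eigDistributed_combination (D := Set.Icc (-Real.pi) Real.pi)
    (P := fun n => gMatrix pq α (M n)) (Q := fun _ => 0)
    (u := symbol pq α) (v := fun _ => 0) (B := coeffMass pq α)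
    (fun n => gMatrix_isHermitian pq _) (fun n => Matrix.isHermitian_zero)
    (fun n => Commute.zero_right _) (fun n => gMatrix_sum_row_le pq h1 h2 _)
    (fun n i => by simpa using hB) measurableSet_Icc
    (by rw [Real.volume_Icc, ENNReal.ofReal_pos]; linarith) (by simp [Real.volume_Icc])
    (continuous_symbol pq h1 h2).measurable measurable_const (abs_symbol_le pq h1 h2)
    (fun _ => by simpa using hB) (fun a b => ?_) hx hy (tendsto_const_nhds (x := (0 : ℝ)))
  · simpa using this
  · rcases Nat.eq_zero_or_pos b with rfl | hb
    · rw [hvol]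
      simpa using tendsto_trace_gMatrix_pow pq h1 h2 hM a
    · simp [zero_pow hb.ne']

end OneDimension

/-! ### Two space dimensions and the rescaled matrices. -/

section TwoDimensions

variable {m n : Type*} [Fintype m] [Fintype n] [DecidableEq m] [DecidableEq n]

theorem kronecker_pow (A : Matrix m m ℝ) (B : Matrix n n ℝ) (q : ℕ) :
    (A ⊗ₖ B) ^ q = (A ^ q) ⊗ₖ (B ^ q) := by
  induction q with
  | zero => simp
  | succ q ih => rw [pow_succ, ih, pow_succ, pow_succ, Matrix.mul_kronecker_mul]

theorem trace_kronecker_one_pow_mul (A : Matrix m m ℝ) (B : Matrix n n ℝ) (a b : ℕ) :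
    ((A ⊗ₖ (1 : Matrix n n ℝ)) ^ a * ((1 : Matrix m m ℝ) ⊗ₖ B) ^ b).trace
      = (A ^ a).trace * (B ^ b).trace := by
  rw [kronecker_pow, kronecker_pow, ← Matrix.mul_kronecker_mul, one_pow, one_pow, mul_one,
    one_mul, Matrix.trace_kronecker]

theorem commute_kronecker_one (A : Matrix m m ℝ) (B : Matrix n n ℝ) :
    Commute (A ⊗ₖ (1 : Matrix n n ℝ)) ((1 : Matrix m m ℝ) ⊗ₖ B) := by
  rw [Commute, SemiconjBy, ← Matrix.mul_kronecker_mul, ← Matrix.mul_kronecker_mul]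
  simp

theorem kronecker_isHermitian {m n : Type*} {A : Matrix m m ℝ} {B : Matrix n n ℝ} (hA : A.IsHermitian)
    (hB : B.IsHermitian) : (A ⊗ₖ B).IsHermitian := by
  rw [Matrix.IsHermitian, Matrix.conjTranspose_kronecker, hA.eq, hB.eq]

theorem sum_abs_kronecker {m n : Type*} [Fintype m] [Fintype n] (A : Matrix m m ℝ) (B : Matrix n n ℝ) (i : m × n) :
    ∑ j, |(A ⊗ₖ B) i j| = (∑ j, |A i.1 j|) * ∑ j, |B i.2 j| := by
  rw [Fintype.sum_prod_type, Finset.sum_mul_sum]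
  simp [Matrix.kroneckerMap_apply, abs_mul]

theorem integral_box_mul (f g : ℝ → ℝ) (a b : ℝ) :
    ∫ t in Set.Icc (fun _ : Fin 2 => a) (fun _ => b), f (t 0) * g (t 1)
      = (∫ x in Set.Icc a b, f x) * ∫ x in Set.Icc a b, g x := by
  have h := MeasureTheory.integral_fintype_prod_eq_prod (𝕜 := ℝ) (ι := Fin 2) (E := fun _ => ℝ)
    ![f, g] (μ := fun _ => MeasureTheory.volume.restrict (Set.Icc a b))
  rw [← MeasureTheory.Measure.restrict_pi_pi, Set.pi_univ_Icc] at h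
  simpa [Fin.prod_univ_two, MeasureTheory.volume_pi] using h

/-- G ⊗ I and I ⊗ G commute. Their mixed traces are products of one-dimensional traces, and by
Fubini the mixed integrals over the square are products too, so the one-dimensional limits multiply.
-/
theorem eigDistributed_two_dim (pq : Shifts) {α : Fin 2 → ℝ} (h1 : ∀ j, 1 < α j)
    (h2 : ∀ j, α j < 2) {M : ℕ → Fin 2 → ℕ} (hM : ∀ j, Tendsto (fun n => M n j) atTop atTop)
    {x y z : ℕ → ℝ} {x₀ y₀ z₀ : ℝ} (hx : Tendsto x atTop (𝓝 x₀)) (hy : Tendsto y atTop (𝓝 y₀))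
    (hz : Tendsto z atTop (𝓝 z₀)) :
    EigDistributed
      (fun n => (x n • (1 : Matrix (Fin (M n 0) × Fin (M n 1)) (Fin (M n 0) × Fin (M n 1)) ℝ)
        + (y n • (gMatrix pq (α 0) (M n 0) ⊗ₖ (1 : Matrix (Fin (M n 1)) (Fin (M n 1)) ℝ))
          + z n • ((1 : Matrix (Fin (M n 0)) (Fin (M n 0)) ℝ) ⊗ₖ
              gMatrix pq (α 1) (M n 1)))).map ((↑) : ℝ → ℂ))
      (fun t : Fin 2 → ℝ =>
        ((x₀ + (y₀ * symbol pq (α 0) (t 0) + z₀ * symbol pq (α 1) (t 1)) : ℝ) : ℂ))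
      (Set.Icc (fun _ => -Real.pi) (fun _ => Real.pi)) := by
  have hpi := Real.pi_pos
  have hvol : MeasureTheory.volume (Set.Icc (fun _ : Fin 2 => -Real.pi) (fun _ => Real.pi))
      = ENNReal.ofReal (2 * Real.pi) * ENNReal.ofReal (2 * Real.pi) := by
    rw [Real.volume_Icc_pi, Fin.prod_univ_two]
    ring_nf
  have hvol' : (MeasureTheory.volume
      (Set.Icc (fun _ : Fin 2 => -Real.pi) (fun _ => Real.pi))).toReal
      = 2 * Real.pi * (2 * Real.pi) := by
    rw [hvol, ENNReal.toReal_mul, ENNReal.toReal_ofReal (by positivity)]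
  refine eigDistributed_combination (B := max (coeffMass pq (α 0)) (coeffMass pq (α 1)))
    (u := fun t : Fin 2 → ℝ => symbol pq (α 0) (t 0))
    (v := fun t : Fin 2 → ℝ => symbol pq (α 1) (t 1))
    (fun n => kronecker_isHermitian (gMatrix_isHermitian pq _) Matrix.isHermitian_one)
    (fun n => kronecker_isHermitian Matrix.isHermitian_one (gMatrix_isHermitian pq _))
    (fun n => commute_kronecker_one _ _) (fun n i => ?_) (fun n i => ?_) measurableSet_Icc
    ?_ ?_ ((continuous_symbol pq (h1 0) (h2 0)).measurable.comp (measurable_pi_apply 0))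
    ((continuous_symbol pq (h1 1) (h2 1)).measurable.comp (measurable_pi_apply 1))
    (fun t => (abs_symbol_le pq (h1 0) (h2 0) _).trans (le_max_left _ _))
    (fun t => (abs_symbol_le pq (h1 1) (h2 1) _).trans (le_max_right _ _))
    (fun a b => ?_) hx hy hz
  · rw [sum_abs_kronecker, sum_abs_one_row, mul_one]
    exact (gMatrix_sum_row_le pq (h1 0) (h2 0) _ _).trans (le_max_left _ _)
  · rw [sum_abs_kronecker, sum_abs_one_row, one_mul]
    exact (gMatrix_sum_row_le pq (h1 1) (h2 1) _ _).trans (le_max_right _ _)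
  · rw [hvol]
    exact ENNReal.mul_pos (ENNReal.ofReal_pos.2 (by positivity)).ne'
      (ENNReal.ofReal_pos.2 (by positivity)).ne'
  · rw [hvol]
    exact ENNReal.mul_lt_top ENNReal.ofReal_lt_top ENNReal.ofReal_lt_top
  · rw [hvol', integral_box_mul (fun x => symbol pq (α 0) x ^ a) (fun x => symbol pq (α 1) x ^ b),
      mul_inv, mul_mul_mul_comm]
    refine ((tendsto_trace_gMatrix_pow pq (h1 0) (h2 0) (hM 0) a).mul
      (tendsto_trace_gMatrix_pow pq (h1 1) (h2 1) (hM 1) b)).congr fun n => ?_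
    rw [trace_kronecker_one_pow_mul, Fintype.card_prod, Fintype.card_fin, Fintype.card_fin]
    push_cast
    rw [mul_inv, mul_mul_mul_comm]

theorem posDef_coeffMatrix₂ (pq : Shifts) {s ε : ℝ} {α : Fin 2 → ℝ} {ht : ℝ} {hx : Fin 2 → ℝ}
    (hs : 0 < s) (h1 : ∀ j, 1 < α j) (h2 : ∀ j, α j < 2) (ht0 : 0 < ht) (hx0 : ∀ j, 0 < hx j)
    (M : Fin 2 → ℕ) : (coeffMatrix₂ pq s ε α ht hx M).PosDef := by
  refine posDef_one_add (by positivity) (by positivity) ?_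
  have key : ∀ j, (-(cBar (α j) (hx j) • gMatrix pq (α j) (M j))).PosSemidef := fun j => by
    rw [← smul_neg]
    exact (posSemidef_neg_gMatrix pq (h1 j) (h2 j) (M j)).smul (cBar_pos (h1 j) (h2 j) (hx0 j)).le
  rw [neg_add]
  refine Matrix.PosSemidef.add ?_ ?_
  · have := (key 0).kronecker (Matrix.PosSemidef.one (n := Fin (M 1)) (R := ℝ))
    rwa [← neg_one_smul ℝ, Matrix.smul_kronecker, neg_one_smul] at this
  · have := (Matrix.PosSemidef.one (n := Fin (M 0)) (R := ℝ)).kronecker (key 1)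
    rwa [← neg_one_smul ℝ, Matrix.kronecker_smul, neg_one_smul] at this

theorem smul_coeffMatrix (pq : Shifts) (c s ε α ht hx : ℝ) (M : ℕ) :
    c • coeffMatrix pq s ε α ht hx M = (c * (1 + s * ht)) • (1 : Matrix (Fin M) (Fin M) ℝ)
      + (-ε ^ 2 * (c * gam α ht hx)) • gMatrix pq α M := by
  rw [coeffMatrix, gam_eq_mul_cBar, smul_sub, smul_smul, smul_smul, sub_eq_add_neg, ← neg_smul]
  congr 2
  ring

theorem smul_coeffMatrix₂ (pq : Shifts) (c s ε : ℝ) (α : Fin 2 → ℝ) (ht : ℝ) (hx : Fin 2 → ℝ)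
    (M : Fin 2 → ℕ) :
    c • coeffMatrix₂ pq s ε α ht hx M
      = (c * (1 + s * ht)) • (1 : Matrix (Fin (M 0) × Fin (M 1)) (Fin (M 0) × Fin (M 1)) ℝ)
      + ((-ε ^ 2 * (c * gam (α 0) ht (hx 0))) •
          (gMatrix pq (α 0) (M 0) ⊗ₖ (1 : Matrix (Fin (M 1)) (Fin (M 1)) ℝ))
        + (-ε ^ 2 * (c * gam (α 1) ht (hx 1))) •
          ((1 : Matrix (Fin (M 0)) (Fin (M 0)) ℝ) ⊗ₖ gMatrix pq (α 1) (M 1))) := by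
  rw [coeffMatrix₂, gam_eq_mul_cBar, gam_eq_mul_cBar, Matrix.smul_kronecker,
    Matrix.kronecker_smul, smul_sub, smul_smul, smul_smul, smul_add, smul_smul, smul_smul,
    sub_eq_add_neg, neg_add, ← neg_smul, ← neg_smul]
  congr 3 <;> ring_nf

/-- The rescaled two-level matrices, for scaling factors `c n` such that `c n` and the
`c n * γ_j` converge. -/
theorem eigDistributed_smul_coeffMatrix₂ (pq : Shifts) (s ε : ℝ) {α : Fin 2 → ℝ}
    (h1 : ∀ j, 1 < α j) (h2 : ∀ j, α j < 2) {M : ℕ → Fin 2 → ℕ}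
    (hM : ∀ j, Tendsto (fun n => M n j) atTop atTop) {ht c : ℕ → ℝ} {hx : ℕ → Fin 2 → ℝ}
    (ht0 : Tendsto ht atTop (𝓝 0)) {c₀ : ℝ} {κ : Fin 2 → ℝ} (hc : Tendsto c atTop (𝓝 c₀))
    (hκ : ∀ j, Tendsto (fun n => c n * gam (α j) (ht n) (hx n j)) atTop (𝓝 (κ j))) :
    EigDistributed
      (fun n => (c n • coeffMatrix₂ pq s ε α (ht n) (hx n) (M n)).map ((↑) : ℝ → ℂ))
      (fun t : Fin 2 → ℝ => ((c₀ - ε ^ 2 *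
        (κ 0 * symbol pq (α 0) (t 0) + κ 1 * symbol pq (α 1) (t 1)) : ℝ) : ℂ))
      (Set.Icc (fun _ => -Real.pi) (fun _ => Real.pi)) := by
  have hx₀ : Tendsto (fun n => c n * (1 + s * ht n)) atTop (𝓝 c₀) := by
    simpa using hc.mul ((ht0.const_mul s).const_add 1)
  have := eigDistributed_two_dim pq h1 h2 hM hx₀ ((hκ 0).const_mul (-ε ^ 2))
    ((hκ 1).const_mul (-ε ^ 2))
  simp_rw [smul_coeffMatrix₂]
  convert this using 3
  ring

/-- The rescaled one-level matrices, for scaling factors `c n` such that `c n` and `c n * γ`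
converge. -/
theorem eigDistributed_smul_coeffMatrix (pq : Shifts) (s ε : ℝ) {α : ℝ} (h1 : 1 < α) (h2 : α < 2)
    {M : ℕ → ℕ} (hM : Tendsto M atTop atTop) {ht c hx : ℕ → ℝ} (ht0 : Tendsto ht atTop (𝓝 0))
    {c₀ κ : ℝ} (hc : Tendsto c atTop (𝓝 c₀))
    (hκ : Tendsto (fun n => c n * gam α (ht n) (hx n)) atTop (𝓝 κ)) :
    EigDistributed
      (fun n => (c n • coeffMatrix pq s ε α (ht n) (hx n) (M n)).map ((↑) : ℝ → ℂ))
      (fun t : ℝ => ((c₀ - ε ^ 2 * κ * symbol pq α t : ℝ) : ℂ))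
      (Set.Icc (-Real.pi) Real.pi) := by
  have hx₀ : Tendsto (fun n => c n * (1 + s * ht n)) atTop (𝓝 c₀) := by
    simpa using hc.mul ((ht0.const_mul s).const_add 1)
  have := eigDistributed_one_dim pq h1 h2 hM hx₀ (hκ.const_mul (-ε ^ 2))
  simp_rw [smul_coeffMatrix]
  convert this using 3
  ring

/-- Once h/g < 1 the maximum is g, so domination is the case of limiting proportions 1 and 0. -/
theorem tendsto_div_max_of_tendsto_div {g h : ℕ → ℝ} (hg : ∀ n, 0 < g n)
    (hlim : Tendsto (fun n => h n / g n) atTop (𝓝 0)) :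
    Tendsto (fun n => g n / max (g n) (h n)) atTop (𝓝 1) ∧
      Tendsto (fun n => h n / max (g n) (h n)) atTop (𝓝 0) := by
  have hmax : ∀ᶠ n in atTop, max (g n) (h n) = g n := by
    filter_upwards [hlim.eventually (gt_mem_nhds one_pos)] with n hn
    rw [div_lt_one (hg n)] at hn
    exact max_eq_left hn.le
  constructor
  · refine tendsto_const_nhds.congr' ?_
    filter_upwards [hmax] with n hn
    rw [hn, div_self (hg n).ne']
  · refine hlim.congr' ?_
    filter_upwards [hmax] with n hn
    rw [hn]

end TwoDimensions

end

end SFAC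

/-! ### The theorem: each regime as a choice of scaling factor. -/

open SFAC in
theorem theorem4p3 (pq : Shifts) (s ε : ℝ) (hs : 0 < s) (hε : 0 < ε) :
    -- one space dimension
    (∀ (α a b : ℝ), 1 < α → α < 2 → a < b →
      ∀ (M : ℕ → ℕ) (ht : ℕ → ℝ), Tendsto M atTop atTop →
        (∀ n, 0 < ht n) → Tendsto ht atTop (𝓝 0) →
        ∀ (hx γ : ℕ → ℝ) (A : ∀ n, Matrix (Fin (M n)) (Fin (M n)) ℝ),
          (∀ n, hx n = step a b (M n)) → (∀ n, γ n = gam α (ht n) (hx n)) →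
          (∀ n, A n = coeffMatrix pq s ε α (ht n) (hx n) (M n)) →
          (∀ n, (A n).PosDef) ∧
          (∀ γs : ℝ, Tendsto γ atTop (𝓝 γs) →
            EigDistributed (fun n => (A n).map ((↑) : ℝ → ℂ))
              (fun x : ℝ => ((1 - ε ^ 2 * γs * symbol pq α x : ℝ) : ℂ))
              (Set.Icc (-Real.pi) Real.pi)) ∧
          (Tendsto γ atTop atTop →
            EigDistributed (fun n => ((γ n)⁻¹ • A n).map ((↑) : ℝ → ℂ))
              (fun x : ℝ => ((-ε ^ 2 * symbol pq α x : ℝ) : ℂ))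
              (Set.Icc (-Real.pi) Real.pi))) ∧
    -- two space dimensions
    (∀ (α a b : Fin 2 → ℝ), (∀ j, 1 < α j) → (∀ j, α j < 2) → (∀ j, a j < b j) →
      ∀ (M : ℕ → Fin 2 → ℕ) (ht : ℕ → ℝ), (∀ j, Tendsto (fun n => M n j) atTop atTop) →
        (∀ n, 0 < ht n) → Tendsto ht atTop (𝓝 0) →
        ∀ (hx γ : ℕ → Fin 2 → ℝ) (γmax : ℕ → ℝ)
          (A : ∀ n, Matrix (Fin (M n 0) × Fin (M n 1)) (Fin (M n 0) × Fin (M n 1)) ℝ),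
          (∀ n j, hx n j = step (a j) (b j) (M n j)) →
          (∀ n j, γ n j = gam (α j) (ht n) (hx n j)) →
          (∀ n, γmax n = max (γ n 0) (γ n 1)) →
          (∀ n, A n = coeffMatrix₂ pq s ε α (ht n) (hx n) (M n)) →
          (∀ n, (A n).PosDef) ∧
          -- both ratios converge to finite limits
          (∀ γs : Fin 2 → ℝ, (∀ j, Tendsto (fun n => γ n j) atTop (𝓝 (γs j))) →
            EigDistributed (fun n => (A n).map ((↑) : ℝ → ℂ))
              (fun x : Fin 2 → ℝ => ((1 - ε ^ 2 *
                (γs 0 * symbol pq (α 0) (x 0) + γs 1 * symbol pq (α 1) (x 1)) : ℝ) : ℂ))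
              (Set.Icc (fun _ => -Real.pi) (fun _ => Real.pi)) ∧
            (∀ j k, α k < α j → (fun n => hx n j) =O[atTop] (fun n => hx n k) → γs k = 0)) ∧
          -- the larger ratio diverges and dominates the other one
          (∀ j k, j ≠ k → Tendsto γmax atTop atTop →
            Tendsto (fun n => γ n k / γ n j) atTop (𝓝 0) →
            EigDistributed (fun n => ((γmax n)⁻¹ • A n).map ((↑) : ℝ → ℂ))
              (fun x : Fin 2 → ℝ => ((-ε ^ 2 * symbol pq (α j) (x j) : ℝ) : ℂ))
              (Set.Icc (fun _ => -Real.pi) (fun _ => Real.pi))) ∧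
          -- domination is automatic for different orders and grids of comparable size
          (∀ j k, α k < α j → (fun n => hx n j) =O[atTop] (fun n => hx n k) →
            Tendsto (fun n => γ n k / γ n j) atTop (𝓝 0)) ∧
          -- the larger ratio diverges, without domination
          (∀ κ : Fin 2 → ℝ, Tendsto γmax atTop atTop →
            (∀ j, Tendsto (fun n => γ n j / γmax n) atTop (𝓝 (κ j))) →
            EigDistributed (fun n => ((γmax n)⁻¹ • A n).map ((↑) : ℝ → ℂ))
              (fun x : Fin 2 → ℝ => ((-ε ^ 2 *
                (κ 0 * symbol pq (α 0) (x 0) + κ 1 * symbol pq (α 1) (x 1)) : ℝ) : ℂ))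
              (Set.Icc (fun _ => -Real.pi) (fun _ => Real.pi)))) := by 
  refine ⟨fun α a b h1 h2 hab M ht hM ht0 htlim hx γ A hhx hγ hA => ?_,
    fun α a b h1 h2 hab M ht hM ht0 htlim hx γ γmax A hhx hγ hγmax hA => ?_⟩
  · obtain rfl : A = fun n => coeffMatrix pq s ε α (ht n) (hx n) (M n) := funext hA
    obtain rfl : γ = fun n => gam α (ht n) (hx n) := funext hγ
    have hx0 : ∀ n, 0 < hx n := fun n => hhx n ▸ step_pos hab _
    have hg : ∀ n, 0 < gam α (ht n) (hx n) := fun n => gam_pos h1 h2 (hx0 n) (ht0 n)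
    refine ⟨fun n => posDef_coeffMatrix pq hs h1 h2 (ht0 n) (hx0 n) _, fun γs hγs => ?_,
      fun hγ' => ?_⟩
    · have := eigDistributed_smul_coeffMatrix pq s ε h1 h2 hM htlim
        (tendsto_const_nhds (x := (1 : ℝ))) (by simpa using hγs)
      simpa only [one_smul] using this
    -- The scaling is γ⁻¹: the identity part tends to 0, and γ⁻¹γ is constantly 1.
    · have := eigDistributed_smul_coeffMatrix pq s ε h1 h2 hM htlim
        (c := fun n => (gam α (ht n) (hx n))⁻¹) (hx := hx) (κ := 1) hγ'.inv_tendsto_atTop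
        (tendsto_const_nhds.congr fun n => (inv_mul_cancel₀ (hg n).ne').symm)
      simpa only [zero_sub, mul_one, neg_mul] using this
  · obtain rfl : A = fun n => coeffMatrix₂ pq s ε α (ht n) (hx n) (M n) := funext hA
    obtain rfl : γ = fun n j => gam (α j) (ht n) (hx n j) := funext fun n => funext (hγ n)
    have hx0 : ∀ n j, 0 < hx n j := fun n j => hhx n j ▸ step_pos (hab j) _
    have hg : ∀ n j, 0 < gam (α j) (ht n) (hx n j) := fun n j =>
      gam_pos (h1 j) (h2 j) (hx0 n j) (ht0 n)
    have hxlim : ∀ j, Tendsto (fun n => hx n j) atTop (𝓝 0) := fun j => by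
      simpa only [hhx] using tendsto_step (a j) (b j) (hM j)
    have hauto : ∀ j k, α k < α j → (fun n => hx n j) =O[atTop] (fun n => hx n k) →
        Tendsto (fun n => gam (α k) (ht n) (hx n k) / gam (α j) (ht n) (hx n j)) atTop (𝓝 0) :=
      fun j k hkj hO => tendsto_gam_div_gam (h1 j) (h2 j) (h1 k) (h2 k) hkj ht0
        (fun n => hx0 n j) (fun n => hx0 n k) (hxlim j) hO
    have hscaled : ∀ κ : Fin 2 → ℝ, Tendsto γmax atTop atTop →
        (∀ j, Tendsto (fun n => gam (α j) (ht n) (hx n j) / γmax n) atTop (𝓝 (κ j))) →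
        EigDistributed
          (fun n => ((γmax n)⁻¹ • coeffMatrix₂ pq s ε α (ht n) (hx n) (M n)).map ((↑) : ℝ → ℂ))
          (fun x : Fin 2 → ℝ => ((-ε ^ 2 *
            (κ 0 * symbol pq (α 0) (x 0) + κ 1 * symbol pq (α 1) (x 1)) : ℝ) : ℂ))
          (Set.Icc (fun _ => -Real.pi) (fun _ => Real.pi)) := fun κ hmax hκ => by
      have := eigDistributed_smul_coeffMatrix₂ pq s ε h1 h2 hM htlim hmax.inv_tendsto_atTop
        (fun j => (hκ j).congr fun n => div_eq_inv_mul _ _)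
      simpa only [zero_sub, neg_mul, Pi.inv_apply] using this
    refine ⟨fun n => posDef_coeffMatrix₂ pq hs h1 h2 (ht0 n) (hx0 n) _,
      fun γs hγs => ⟨?_, fun j k hkj hO => ?_⟩, fun j k hjk hmax hdom => ?_, hauto, hscaled⟩
    · have := eigDistributed_smul_coeffMatrix₂ pq s ε h1 h2 hM htlim
        (tendsto_const_nhds (x := (1 : ℝ))) (fun j => by simpa using hγs j)
      simpa only [one_smul] using this
    -- γ_k = (γ_k/γ_j) γ_j tends to 0 · γ_j* = 0, and limits are unique.
    · have hprod := (hauto j k hkj hO).mul (hγs j)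
      rw [zero_mul] at hprod
      exact tendsto_nhds_unique (hγs k)
        (hprod.congr fun n => div_mul_cancel₀ _ (hg n j).ne')
    · obtain ⟨hj, hk⟩ := tendsto_div_max_of_tendsto_div (fun n => hg n j) hdom
      -- Domination by j is the general scaled regime with κ_j = 1 and κ_k = 0.
      have hκ := hscaled (Pi.single j 1) hmax fun i => by
        fin_cases j <;> fin_cases k <;> fin_cases i <;>
          simp_all [max_comm]
      fin_cases j <;> simpa using hκ
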